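/- A sequence $(x_n)_{n\in\mathbb{N}}$ of reals is uniformly distributed modulo one if for every interval $I\subseteq[0,1]$ we have $\lim_{n\to\infty}\frac{1}{n}|\{i<n : \{x_i\}\in I\}|=\lambda(I)$, where $\{x_i\}$ is the fractional part of $x_i$ and $\lambda$ is Lebesgue measure. A Schnorr test is a sequence $(G_j)_{j\in\mathbb{N}}$ of subsets of $[0,1]$ of the form $G_j=[0,1]\cap\bigcup_i(b^j_i,c^j_i)$, where the rationals $b^j_i$ and $c^j_i$ are computable from $i$ and $j$, such that $\lambda(G_j)\le 2^{-j}$ for every $j$ and the reals $\lambda(G_j)$ are computable uniformly in $j$ (that is, rational approximations to $\lambda(G_j)$ within $2^{-n}$ are computable from $j$ and $n$). An element $x$ of $[0,1]$ passes the test if $x\notin\bigcap_j G_j$, and it is Schnorr random if it passes every Schnorr test. An element $x$ of $[0,1]$ is UD random if $(a_n x)_{n\in\mathbb{N}}$ is uniformly distributed modulo one for every computable sequence $(a_n)_{n\in\mathbb{N}}$ of distinct integers. (1) Every Schnorr random element of $[0,1]$ is UD random. (2) For each $i\in\mathbb{N}$ let $(a^i_j)_{j\in\mathbb{N}}$ be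 a sequence of distinct integers, such that $a^i_j$ is computable from $i$ and $j$. Then there is a Schnorr test such that for every $x\in[0,1]$ passing it and every $i\in\mathbb{N}$, the sequence $(a^i_j x)_{j\in\mathbb{N}}$ is uniformly distributed modulo one. -/

import Mathlib

open Set Filter Topology MeasureTheory

/-- A sequence of reals is uniformly distributed modulo one: for every interval `I ⊆ [0,1]`
(open, closed, half-open or degenerate), the frequency of the indices `i < n` for which the
fractional part of `x i` lies in `I` tends to the length of `I`. -/
def UniformlyDistributedModOne (x : ℕ → ℝ) : Prop :=
  ∀ I : Set ℝ, I.OrdConnected → I ⊆ Icc (0 : ℝ) 1 →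
    Tendsto (fun n : ℕ => (({i : ℕ | i < n ∧ Int.fract (x i) ∈ I}.ncard : ℕ) : ℝ) / (n : ℝ))
      atTop (𝓝 (volume.real I))

/-- A doubly indexed family of rationals is computable: numerators and (positive)
denominators of a fraction representing `q j i` can be computed from `j` and `i`. -/
def ComputableRat₂ (q : ℕ → ℕ → ℚ) : Prop :=
  ∃ (num : ℕ → ℕ → ℤ) (den : ℕ → ℕ → ℕ), Computable₂ num ∧ Computable₂ den ∧
    ∀ j i, 0 < den j i ∧ q j i = (num j i : ℚ) / (den j i : ℚ)

/-- A sequence of reals is uniformly computable: rational approximations of `r j` to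
within `2⁻ⁿ` can be computed from `j` and `n`. -/
def UniformlyComputableReals (r : ℕ → ℝ) : Prop :=
  ∃ q : ℕ → ℕ → ℚ, ComputableRat₂ q ∧ ∀ j n, |r j - (q j n : ℝ)| ≤ (1 / 2 : ℝ) ^ n

/-- A uniformly effective sequence of effectively open subsets of `[0,1]`: each `G j` is the
restriction to `[0,1]` of a union of open intervals whose rational endpoints are
computable from `j` and the index of the interval. -/
def UniformlyEffectivelyOpen (G : ℕ → Set ℝ) : Prop :=
  ∃ a b : ℕ → ℕ → ℚ, ComputableRat₂ a ∧ ComputableRat₂ b ∧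
    ∀ j, G j = (⋃ i, Ioo (a j i : ℝ) (b j i : ℝ)) ∩ Icc 0 1

/-- Martin-Löf tests on `[0,1]`. -/
structure IsMartinLofTest (G : ℕ → Set ℝ) : Prop where
  effective : UniformlyEffectivelyOpen G
  measure_le : ∀ j, volume (G j) ≤ (2⁻¹ : ENNReal) ^ j

/-- Schnorr tests on `[0,1]`: Martin-Löf tests for which the measure of `G j` is
computable, uniformly in `j`. -/
structure IsSchnorrTest (G : ℕ → Set ℝ) : Prop extends IsMartinLofTest G where
  measure_computable : UniformlyComputableReals fun j => volume.real (G j)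

/-- `x` passes the test `G` if it does not lie in all of the sets `G j`. -/
def PassesTest (x : ℝ) (G : ℕ → Set ℝ) : Prop := x ∉ ⋂ j, G j

/-- Schnorr random elements of `[0,1]`. -/
def IsSchnorrRandom (x : ℝ) : Prop :=
  x ∈ Icc (0 : ℝ) 1 ∧ ∀ G : ℕ → Set ℝ, IsSchnorrTest G → PassesTest x G

/-- UD random elements of `[0,1]`. -/
def IsUDRandom (x : ℝ) : Prop :=
  x ∈ Icc (0 : ℝ) 1 ∧ ∀ a : ℕ → ℤ, Computable a → Function.Injective a →
    UniformlyDistributedModOne fun n => (a n : ℝ) * x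

/-! Fix an arc `[0, c)` with `c` rational and let `f` be its indicator minus `c`, as a function of
period one. The essential estimate is that `f (a x)` and `f (b x)` are almost uncorrelated unless `b
/ a` has small height. If `A = |a| / gcd a b`, the translation by `1 / |a|` leaves `f (a x)`
unchanged and moves `b x` through a full coset of the multiples of `1 / A`, over which the sum of
`f` is bounded by `1` (`abs_sum_arcDeviation_le_one`). The correlation is therefore at most `1 / A`,
and the roles of `a` and `b` can be exchanged.

For a fixed `a ≠ 0` only `O(m ^ 2)` integers `b` give height at most `m`. Hence the sum of `f (a_j
x)` over `m ^ 3` distinct integers has second moment at most `8 m ^ 5`, against the trivial `m ^ 6`.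
By Chebyshev, the mean of `f (a_j x)` reaches `1 / L` in absolute value on a proportion of at most
`8 L ^ 2 / m` of the points. The choice `m = 32 L ^ 6` makes this `1 / (4 L ^ 4)`, which is summable
over all stages. The number of terms, `m ^ 3`, is still polynomial in `L`, so consecutive lengths
have ratio tending to `1`, and convergence of the frequencies along these lengths implies
convergence along all.

For effectiveness everything happens on finite grids. The count of hits is constant on the open
cells of a grid containing all its jumps, so it suffices to evaluate it at cell midpoints, in
integer arithmetic. A stage consists of intervals around the bad grid points, together with tiny
intervals around all grid points, which dispose of the points lying on a jump. Finitely many stages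
have an exactly computable rational measure and the remaining ones an explicit small bound. This
gives a Schnorr test, not merely a Martin-Löf test (`isSchnorrTest_of_stages`). The first claim is
the second for a constant family. -/

/-! ### Computable arithmetic of naturals and integers -/

namespace Computable

variable {α : Type*} [Primcodable α]

theorem natAdd {f g : α → ℕ} (hf : Computable f) (hg : Computable g) :
    Computable fun a => f a + g a :=
  Primrec.nat_add.to_comp.comp hf hg

theorem natMul {f g : α → ℕ} (hf : Computable f) (hg : Computable g) :
    Computable fun a => f a * g a :=
  Primrec.nat_mul.to_comp.comp hf hg

theorem natSub {f g : α → ℕ} (hf : Computable f) (hg : Computable g) :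
    Computable fun a => f a - g a :=
  Primrec.nat_sub.to_comp.comp hf hg

theorem natMod {f g : α → ℕ} (hf : Computable f) (hg : Computable g) :
    Computable fun a => f a % g a :=
  Primrec.nat_mod.to_comp.comp hf hg

theorem natMax {f g : α → ℕ} (hf : Computable f) (hg : Computable g) :
    Computable fun a => max (f a) (g a) :=
  Primrec.nat_max.to_comp.comp hf hg

/-- With truncated subtraction the indicator of `f ≤ g` is `1 - (f - g)`. Decision procedures below
are assembled from such indicators, sums and products. -/
theorem ite_le {f g : α → ℕ} (hf : Computable f) (hg : Computable g) :
    Computable fun a => if f a ≤ g a then 1 else 0 :=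
  ((const 1).natSub (hf.natSub hg)).of_eq fun a => by split_ifs <;> omega

theorem ite_lt {f g : α → ℕ} (hf : Computable f) (hg : Computable g) :
    Computable fun a => if f a < g a then 1 else 0 :=
  (ite_le (succ.comp hf) hg).of_eq fun _ => rfl

theorem natPow {f g : α → ℕ} (hf : Computable f) (hg : Computable g) :
    Computable fun a => f a ^ g a := by
  have h : Computable fun a => (Nat.rec 1 (fun _ IH => IH * f a) (g a) : ℕ) :=
    nat_rec (h := fun a p => p.2 * f a) hg (const 1)
      ((snd.comp snd).natMul (hf.comp fst))
  refine h.of_eq fun a => ?_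
  induction g a with
  | zero => rfl
  | succ n ih => rw [pow_succ, ← ih]

theorem sum_range {f : α → ℕ → ℕ} {n : α → ℕ} (hf : Computable₂ f) (hn : Computable n) :
    Computable fun a => ∑ i ∈ Finset.range (n a), f a i := by
  have h : Computable fun a => (Nat.rec 0 (fun i IH => IH + f a i) (n a) : ℕ) :=
    nat_rec (h := fun a p => p.2 + f a p.1) hn (const 0)
      ((snd.comp snd).natAdd (hf.comp fst (fst.comp snd)))
  refine h.of_eq fun a => ?_
  induction n a with
  | zero => rfl
  | succ n ih => rw [Finset.sum_range_succ, ← ih]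

theorem prod_range {f : α → ℕ → ℕ} {n : α → ℕ} (hf : Computable₂ f) (hn : Computable n) :
    Computable fun a => ∏ i ∈ Finset.range (n a), f a i := by
  have h : Computable fun a => (Nat.rec 1 (fun i IH => IH * f a i) (n a) : ℕ) :=
    nat_rec (h := fun a p => p.2 * f a p.1) hn (const 1)
      ((snd.comp snd).natMul (hf.comp fst (fst.comp snd)))
  refine h.of_eq fun a => ?_
  induction n a with
  | zero => rfl
  | succ n ih => rw [Finset.prod_range_succ, ← ih]

theorem unpair_fst {f : α → ℕ} (hf : Computable f) : Computable fun a => (f a).unpair.1 :=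
  fst.comp (unpair.comp hf)

theorem unpair_snd {f : α → ℕ} (hf : Computable f) : Computable fun a => (f a).unpair.2 :=
  snd.comp (unpair.comp hf)

end Computable

/-- Even codes are the nonnegative integers and odd codes the negative ones, so integer operations
reduce to parity and halving of codes. -/
theorem Int.encode_eq (z : ℤ) :
    Encodable.encode z = if 0 ≤ z then 2 * z.toNat else 2 * (-z - 1).toNat + 1 := by
  rcases z with n | n
  · simp; rfl
  · rw [if_neg (by omega)]
    have : (-Int.negSucc n - 1).toNat = n := by omega
    rw [this]; rfl

theorem computable_int_toNat : Computable Int.toNat := by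
  have h : Primrec fun n : ℕ => if n % 2 = 0 then n / 2 else 0 :=
    Primrec.ite (Primrec.eq.comp (Primrec.nat_mod.comp .id (.const 2)) (.const 0))
      (Primrec.nat_div.comp .id (.const 2)) (.const 0)
  refine (h.comp Primrec.encode).to_comp.of_eq fun z => ?_
  have := Int.encode_eq z
  split_ifs at this ⊢ <;> omega

theorem computable_int_neg_toNat : Computable fun z : ℤ => (-z).toNat := by
  have h : Primrec fun n : ℕ => if n % 2 = 0 then 0 else n / 2 + 1 :=
    Primrec.ite (Primrec.eq.comp (Primrec.nat_mod.comp .id (.const 2)) (.const 0))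
      (.const 0) (Primrec.succ.comp (Primrec.nat_div.comp .id (.const 2)))
  refine (h.comp Primrec.encode).to_comp.of_eq fun z => ?_
  have := Int.encode_eq z
  split_ifs at this ⊢ <;> omega

theorem Computable.natCast_sub_natCast {α : Type*} [Primcodable α] {f g : α → ℕ}
    (hf : Computable f) (hg : Computable g) : Computable fun a => (f a : ℤ) - (g a : ℤ) := by
  have h : Primrec₂ fun x y : ℕ => (x : ℤ) - (y : ℤ) := by
    refine Primrec.encode_iff.1 ?_
    have h : Primrec fun p : ℕ × ℕ =>
        if p.2 ≤ p.1 then 2 * (p.1 - p.2) else 2 * (p.2 - p.1 - 1) + 1 :=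
      Primrec.ite (Primrec.nat_le.comp .snd .fst)
        (Primrec.nat_mul.comp (.const 2) (Primrec.nat_sub.comp .fst .snd))
        (Primrec.succ.comp (Primrec.nat_mul.comp (.const 2)
          (Primrec.nat_sub.comp (Primrec.nat_sub.comp .snd .fst) (.const 1))))
    refine h.of_eq fun p => ?_
    rw [Int.encode_eq]
    dsimp only
    split_ifs <;> omega
  exact h.to_comp.comp hf hg

/-! ### Unions of rational intervals and Schnorr tests built in stages -/

/-- The union of the intervals with centres `p s r / d s` and radii `w s r / d s`, for `r < R s`. -/
def intervalUnion (R d : ℕ → ℕ) (p w : ℕ → ℕ → ℕ) (s : ℕ) : Set ℝ :=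
  ⋃ r ∈ Finset.range (R s),
    Ioo (((p s r : ℝ) - w s r) / d s) (((p s r : ℝ) + w s r) / d s)

theorem mem_intervalUnion {R d : ℕ → ℕ} {p w : ℕ → ℕ → ℕ} {s : ℕ} {x : ℝ} :
    x ∈ intervalUnion R d p w s ↔
      ∃ r < R s, ((p s r : ℝ) - w s r) / d s < x ∧ x < ((p s r : ℝ) + w s r) / d s := by
  simp only [intervalUnion, mem_iUnion, Finset.mem_range, mem_Ioo, exists_prop]

/-- Off the countable set of grid points every point of `[0, 1]` lies in exactly one open cell, and
a cell is either inside `E` or disjoint from it, so the measure is a count of cells. -/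
theorem volumeReal_inter_Icc_of_grid {D : ℕ} (hD : 0 < D) (E : Set ℝ) (P : ℕ → Prop)
    [DecidablePred P] (h : ∀ r < D, P r → Ioo ((r : ℝ) / D) ((r + 1) / D) ⊆ E)
    (h' : ∀ r < D, ¬ P r → Disjoint (Ioo ((r : ℝ) / D) ((r + 1) / D)) E) :
    volume.real (E ∩ Icc 0 1) = ((Finset.range D).filter P).card / (D : ℝ) := by
  have hD' : (0 : ℝ) < D := by exact_mod_cast hD
  have key : (E ∩ Icc 0 1 : Set ℝ) =ᵐ[volume]
      (⋃ r ∈ (Finset.range D).filter P, Ioo ((r : ℝ) / D) ((r + 1) / D) : Set ℝ) := by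
    have hS : (range fun k : ℕ => (k : ℝ) / D).Countable := countable_range _
    filter_upwards [hS.ae_notMem volume] with x hx
    apply propext
    change x ∈ E ∩ Icc 0 1 ↔ x ∈ ⋃ r ∈ (Finset.range D).filter P, Ioo ((r : ℝ) / D) ((r + 1) / D)
    simp only [mem_iUnion, Finset.mem_filter, Finset.mem_range, exists_prop]
    constructor
    · rintro ⟨hxE, hx0, hx1⟩
      have hne : ∀ k : ℕ, (k : ℝ) ≠ x * D := fun k hk => hx ⟨k, by
        simp only; rw [hk]; field_simp⟩
      have h1 : (⌊x * D⌋₊ : ℝ) < x * D :=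
        lt_of_le_of_ne (Nat.floor_le (by positivity)) (hne _)
      have h2 : x * D < (⌊x * D⌋₊ : ℝ) + 1 := Nat.lt_floor_add_one _
      have h3 : ⌊x * D⌋₊ < D := by
        have : (⌊x * D⌋₊ : ℝ) < D := h1.trans_le (by nlinarith)
        exact_mod_cast this
      have hmem : x ∈ Ioo ((⌊x * D⌋₊ : ℝ) / D) ((⌊x * D⌋₊ + 1) / D) :=
        ⟨(div_lt_iff₀ hD').2 h1, (lt_div_iff₀ hD').2 h2⟩
      refine ⟨_, ⟨h3, ?_⟩, hmem⟩
      by_contra hP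
      exact (h' _ h3 hP).le_bot ⟨hmem, hxE⟩
    · rintro ⟨r, ⟨hr, hP⟩, hxr⟩
      have hr' : (r : ℝ) + 1 ≤ D := by exact_mod_cast hr
      exact ⟨h r hr hP hxr, (by positivity : (0 : ℝ) ≤ r / D).trans hxr.1.le,
        hxr.2.le.trans ((div_le_one hD').2 hr')⟩
  rw [measureReal_congr key, measureReal_biUnion_finset (h := fun _ _ => measure_Ioo_lt_top.ne)]
  · rw [Finset.sum_congr rfl (g := fun _ => 1 / (D : ℝ))]
    · simp [div_eq_mul_inv]
    · intro r _
      rw [Real.volume_real_Ioo_of_le (by gcongr; linarith)]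
      ring
  · intro r _ r' _ hrr'
    refine Set.disjoint_left.2 fun x hx hx' => hrr' ?_
    have e1 := (div_lt_div_iff_of_pos_right hD').1 (hx.1.trans hx'.2)
    have e2 := (div_lt_div_iff_of_pos_right hD').1 (hx'.1.trans hx.2)
    have e1' : r < r' + 1 := by exact_mod_cast e1
    have e2' : r' < r + 1 := by exact_mod_cast e2
    omega
  · exact fun _ _ => measurableSet_Ioo

/-- The endpoints `(p ± w) / d` are multiples of `1 / D`, so they cannot cut a cell. The criterion
is arranged without subtraction so that it can be decided in `ℕ`. -/
theorem Ioo_subset_or_disjoint_of_dvd {d D : ℕ} (hD : 0 < D) (hdD : d ∣ D) (p w r : ℕ) :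
    (p * D ≤ r * d + w * D ∧ (r + 1) * d ≤ (p + w) * D →
      Ioo ((r : ℝ) / D) ((r + 1) / D) ⊆ Ioo (((p : ℝ) - w) / d) (((p : ℝ) + w) / d)) ∧
    (¬ (p * D ≤ r * d + w * D ∧ (r + 1) * d ≤ (p + w) * D) →
      Disjoint (Ioo ((r : ℝ) / D) ((r + 1) / D)) (Ioo (((p : ℝ) - w) / d) (((p : ℝ) + w) / d))) := by
  obtain ⟨q, rfl⟩ := hdD
  have hd : 0 < d := Nat.pos_of_mul_pos_right hD
  have hq : 0 < q := Nat.pos_of_mul_pos_left hD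
  have hd' : (0 : ℝ) < d := by exact_mod_cast hd
  have hq' : (0 : ℝ) < q := by exact_mod_cast hq
  have e1 : p * (d * q) ≤ r * d + w * (d * q) ↔ p * q ≤ r + w * q := by
    rw [show p * (d * q) = d * (p * q) by ring,
      show r * d + w * (d * q) = d * (r + w * q) by ring, Nat.mul_le_mul_left_iff hd]
  have e2 : (r + 1) * d ≤ (p + w) * (d * q) ↔ r + 1 ≤ (p + w) * q := by
    rw [show (r + 1) * d = d * (r + 1) by ring,
      show (p + w) * (d * q) = d * ((p + w) * q) by ring, Nat.mul_le_mul_left_iff hd]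
  rw [e1, e2]
  have f1 : ((p : ℝ) - w) / d = ((p : ℝ) - w) * q / (d * q : ℕ) := by push_cast; field_simp
  have f2 : ((p : ℝ) + w) / d = ((p : ℝ) + w) * q / (d * q : ℕ) := by push_cast; field_simp
  have hD' : (0 : ℝ) < (d * q : ℕ) := by exact_mod_cast hD
  rw [f1, f2]
  constructor
  · rintro ⟨h1, h2⟩
    have h1' : (p : ℝ) * q ≤ r + w * q := by exact_mod_cast h1
    have h2' : (r : ℝ) + 1 ≤ (p + w) * q := by exact_mod_cast h2
    exact Ioo_subset_Ioo (by gcongr; linarith) (by gcongr)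
  · intro h
    refine Set.disjoint_left.2 fun x hx hx' => h ?_
    have e1 := (div_lt_div_iff_of_pos_right hD').1 (hx'.1.trans hx.2)
    have e2 := (div_lt_div_iff_of_pos_right hD').1 (hx.1.trans hx'.2)
    constructor
    · have : (p : ℝ) * q < r + w * q + 1 := by linarith
      have : p * q < r + w * q + 1 := by exact_mod_cast this
      omega
    · have : r < (p + w) * q := by exact_mod_cast e2
      omega

/-- The number of cells of the grid of mesh `1 / D` covered by one of the intervals of
the stages `s` with `2 ^ m ≤ s < 2 ^ n`. -/
def coveredCells (R d : ℕ → ℕ) (p w : ℕ → ℕ → ℕ) (D m n : ℕ) : ℕ :=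
  ∑ r ∈ Finset.range D, if 1 ≤ ∑ s ∈ Finset.range (2 ^ n), (if 2 ^ m ≤ s then 1 else 0) *
      ∑ i ∈ Finset.range (R s), (if p s i * D ≤ r * d s + w s i * D then 1 else 0) *
        (if (r + 1) * d s ≤ (p s i + w s i) * D then 1 else 0) then 1 else 0

/-- The product of the denominators is a common multiple of them, so one grid resolves all the
stages involved and the measure is an explicit fraction. -/
theorem volumeReal_stages_inter_Icc (R d : ℕ → ℕ) (p w : ℕ → ℕ → ℕ) (hd : ∀ s, 0 < d s)
    (m n : ℕ) :
    volume.real ((⋃ s ∈ Finset.Ico (2 ^ m) (2 ^ n), intervalUnion R d p w s) ∩ Icc 0 1) =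
      coveredCells R d p w (∏ s ∈ Finset.range (2 ^ n), d s) m n /
        ((∏ s ∈ Finset.range (2 ^ n), d s : ℕ) : ℝ) := by
  set D := ∏ s ∈ Finset.range (2 ^ n), d s with hDdef
  have hD : 0 < D := Finset.prod_pos fun s _ => hd s
  have hdvd : ∀ s < 2 ^ n, d s ∣ D := fun s hs => Finset.dvd_prod_of_mem _ (by simpa using hs)
  classical
  have key := volumeReal_inter_Icc_of_grid hD
    (⋃ s ∈ Finset.Ico (2 ^ m) (2 ^ n), intervalUnion R d p w s)
    (fun r => ∃ s, 2 ^ m ≤ s ∧ s < 2 ^ n ∧ ∃ i < R s,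
      p s i * D ≤ r * d s + w s i * D ∧ (r + 1) * d s ≤ (p s i + w s i) * D) ?_ ?_
  · rw [key, coveredCells, Finset.card_filter]
    congr 2
    refine Finset.sum_congr rfl fun r _ => if_congr ?_ rfl rfl
    rw [Nat.one_le_iff_ne_zero, Ne, Finset.sum_eq_zero_iff]
    push Not
    constructor
    · rintro ⟨s, hs1, hs2, i, hi, h1, h2⟩
      refine ⟨s, by simpa using hs2, mul_ne_zero (by simp [hs1]) fun h0 => ?_⟩
      have := Finset.sum_eq_zero_iff.1 h0 i (by simpa using hi)
      simp [h1, h2] at this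
    · rintro ⟨s, hs, h0⟩
      have h1 := left_ne_zero_of_mul h0
      obtain ⟨i, hi, h2⟩ := Finset.exists_ne_zero_of_sum_ne_zero (right_ne_zero_of_mul h0)
      refine ⟨s, by simpa using h1, by simpa using hs, i, by simpa using hi, ?_, ?_⟩
      · simpa using left_ne_zero_of_mul h2
      · simpa using right_ne_zero_of_mul h2
  · rintro r - ⟨s, hs1, hs2, i, hi, h⟩
    refine ((Ioo_subset_or_disjoint_of_dvd hD (hdvd s hs2) _ _ _).1 h).trans ?_
    intro x hx
    simp only [mem_iUnion, Finset.mem_Ico]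
    exact ⟨s, ⟨hs1, hs2⟩, mem_intervalUnion.2 ⟨i, hi, hx.1, hx.2⟩⟩
  · intro r _ h
    refine Set.disjoint_left.2 fun x hx hx' => h ?_
    simp only [mem_iUnion, Finset.mem_Ico] at hx'
    obtain ⟨s, ⟨hs1, hs2⟩, hx'⟩ := hx'
    obtain ⟨i, hi, hx1, hx2⟩ := mem_intervalUnion.1 hx'
    refine ⟨s, hs1, hs2, i, hi, ?_⟩
    by_contra hc
    exact ((Ioo_subset_or_disjoint_of_dvd hD (hdvd s hs2) _ _ _).2 hc).le_bot ⟨hx, hx1, hx2⟩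

theorem computable_coveredCells {R d : ℕ → ℕ} {p w : ℕ → ℕ → ℕ} (hR : Computable R)
    (hd : Computable d) (hp : Computable₂ p) (hw : Computable₂ w) {α : Type*} [Primcodable α]
    {D m n : α → ℕ} (hD : Computable D) (hm : Computable m) (hn : Computable n) :
    Computable fun a => coveredCells R d p w (D a) (m a) (n a) := by
  refine .sum_range (.mk (.ite_le (.const 1) (.sum_range (.mk (.natMul
    (.ite_le (.natPow (.const 2) ?_) ?_) (.sum_range (.mk (.natMul (.ite_le ?_ ?_) (.ite_le ?_ ?_)))
    ?_))) ?_))) hD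
  · exact hm.comp (.comp .fst .fst)
  · exact .snd
  · exact .natMul (hp.comp (.comp .snd .fst) .snd) (hD.comp (.comp .fst (.comp .fst .fst)))
  · exact .natAdd (.natMul (.comp .snd (.comp .fst .fst)) (hd.comp (.comp .snd .fst)))
      (.natMul (hw.comp (.comp .snd .fst) .snd) (hD.comp (.comp .fst (.comp .fst .fst))))
  · exact .natMul (.natAdd (.comp .snd (.comp .fst .fst)) (.const 1)) (hd.comp (.comp .snd .fst))
  · exact .natMul (.natAdd (hp.comp (.comp .snd .fst) .snd) (hw.comp (.comp .snd .fst) .snd))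
      (hD.comp (.comp .fst (.comp .fst .fst)))
  · exact hR.comp .snd
  · exact .natPow (.const 2) (hn.comp .fst)

theorem hasSum_one_div_mul_succ {S : ℕ} (hS : 0 < S) :
    HasSum (fun k : ℕ => 1 / (((S + k : ℕ) : ℝ) * ((S + k : ℕ) + 1))) (1 / (S : ℝ)) := by
  rw [hasSum_iff_tendsto_nat_of_nonneg (fun k => by positivity)]
  have hS' : (0 : ℝ) < S := by exact_mod_cast hS
  have h : ∀ n : ℕ, ∑ k ∈ Finset.range n, 1 / (((S + k : ℕ) : ℝ) * ((S + k : ℕ) + 1)) =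
      1 / (S : ℝ) - 1 / ((S : ℝ) + n) := by
    intro n
    induction n with
    | zero => simp
    | succ n ih =>
      rw [Finset.sum_range_succ, ih]
      push_cast
      field_simp
      ring
  simp only [h]
  have : Tendsto (fun n : ℕ => 1 / ((S : ℝ) + n)) atTop (𝓝 0) :=
    (tendsto_const_nhds.div_atTop (tendsto_atTop_add_const_left _ _ tendsto_natCast_atTop_atTop))
  simpa using this.const_sub (1 / (S : ℝ))

theorem volume_intervalUnion_le {R d : ℕ → ℕ} {p w : ℕ → ℕ → ℕ} {s : ℕ} {c : ℝ}
    (h : ∑ r ∈ Finset.range (R s), 2 * (w s r : ℝ) / d s ≤ c) :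
    volume (intervalUnion R d p w s) ≤ ENNReal.ofReal c := by
  refine (measure_biUnion_finset_le _ _).trans ?_
  refine le_trans (le_of_eq ?_) (ENNReal.ofReal_le_ofReal h)
  rw [ENNReal.ofReal_sum_of_nonneg fun r _ => by positivity]
  refine Finset.sum_congr rfl fun r _ => ?_
  rw [Real.volume_Ioo]
  congr 1
  ring

/-- The bounds telescope. Stage `0` is excluded because its bound `1 / (0 * 1)` would be `0` by
convention; the tests below start at `2 ^ m ≥ 1`. -/
theorem volume_tail_le {R d : ℕ → ℕ} {p w : ℕ → ℕ → ℕ}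
    (h : ∀ s, 0 < s → ∑ r ∈ Finset.range (R s), 2 * (w s r : ℝ) / d s ≤ 1 / ((s : ℝ) * (s + 1)))
    {S : ℕ} (hS : 0 < S) :
    volume (⋃ s, intervalUnion R d p w (S + s)) ≤ ENNReal.ofReal (1 / S) := by
  refine (measure_iUnion_le _).trans ?_
  have hs := hasSum_one_div_mul_succ hS
  rw [← hs.tsum_eq, ENNReal.ofReal_tsum_of_nonneg (fun k => by positivity) hs.summable]
  exact ENNReal.tsum_le_tsum fun k => volume_intervalUnion_le (h _ (by omega))

theorem ComputableRat₂.of_nat {u v d : ℕ → ℕ → ℕ} (hu : Computable₂ u) (hv : Computable₂ v)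
    (hd : Computable₂ d) (hd0 : ∀ j i, 0 < d j i) :
    ComputableRat₂ fun j i => ((u j i : ℚ) - v j i) / d j i :=
  ⟨fun j i => (u j i : ℤ) - (v j i : ℤ), d, .mk (Computable.natCast_sub_natCast hu hv), hd,
    fun j i => ⟨hd0 j i, by push_cast; rfl⟩⟩

/-- The stages from `2 ^ n` on have total measure at most `2 ^ (-n)`, so the exact measure of those
before `2 ^ n` is the required approximation. -/
theorem isSchnorrTest_of_stages {R d : ℕ → ℕ} {p w : ℕ → ℕ → ℕ} (hR : Computable R)
    (hd : Computable d) (hp : Computable₂ p) (hw : Computable₂ w) (hR0 : ∀ s, 0 < R s)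
    (hd0 : ∀ s, 0 < d s)
    (h : ∀ s, 0 < s → ∑ r ∈ Finset.range (R s), 2 * (w s r : ℝ) / d s ≤ 1 / ((s : ℝ) * (s + 1))) :
    IsSchnorrTest fun m => (⋃ s, intervalUnion R d p w (2 ^ m + s)) ∩ Icc 0 1 := by
  have hvol : ∀ m : ℕ, volume ((⋃ s, intervalUnion R d p w (2 ^ m + s)) ∩ Icc (0 : ℝ) 1) ≤
      ENNReal.ofReal (1 / ((2 ^ m : ℕ) : ℝ)) := fun m =>
    (measure_mono inter_subset_left).trans (volume_tail_le h (by positivity))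
  refine ⟨⟨?_, ?_⟩, ?_⟩
  · let st : ℕ → ℕ → ℕ := fun m i => 2 ^ m + i.unpair.1
    -- Each finite list of intervals is enumerated cyclically, which needs `0 < R s`.
    let ix : ℕ → ℕ → ℕ := fun m i => i.unpair.2 % R (st m i)
    have hst : Computable₂ st :=
      .mk (.natAdd (.natPow (.const 2) .fst) (.unpair_fst .snd))
    have hix : Computable₂ ix := .mk (.natMod (.unpair_snd .snd) (hR.comp hst))
    have hP : Computable₂ fun m i => p (st m i) (ix m i) := .mk (hp.comp hst hix)
    have hW : Computable₂ fun m i => w (st m i) (ix m i) := .mk (hw.comp hst hix)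
    have hDen : Computable₂ fun m i => d (st m i) := .mk (hd.comp hst)
    have hPW : Computable₂ fun m i => p (st m i) (ix m i) + w (st m i) (ix m i) :=
      .mk (Computable.natAdd hP hW)
    have hZ : Computable₂ fun _ _ : ℕ => 0 := .mk (.const 0)
    refine ⟨_, _, .of_nat hP hW hDen fun _ _ => hd0 _, .of_nat hPW hZ hDen fun _ _ => hd0 _, fun m => ?_⟩
    refine congrArg (· ∩ Icc (0 : ℝ) 1) (Set.ext fun x => ?_)
    simp only [mem_iUnion, mem_intervalUnion, mem_Ioo]
    push_cast
    simp only [sub_zero]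
    constructor
    · rintro ⟨s, r, hr, hx⟩
      refine ⟨Nat.pair s r, ?_⟩
      simpa [st, ix, Nat.mod_eq_of_lt hr] using hx
    · rintro ⟨i, hx⟩
      exact ⟨i.unpair.1, ix m i, Nat.mod_lt _ (hR0 _), hx⟩
  · intro m
    refine (hvol m).trans (le_of_eq ?_)
    rw [one_div, ENNReal.ofReal_inv_of_pos (by positivity)]
    simp [ENNReal.inv_pow]
  · have hDn : Computable₂ fun _ n : ℕ => ∏ s ∈ Finset.range (2 ^ n), d s :=
      .mk (.prod_range (.mk (hd.comp .snd)) (.natPow (.const 2) .snd))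
    have hq : ComputableRat₂ fun m n =>
        ((coveredCells R d p w (∏ s ∈ Finset.range (2 ^ n), d s) m n : ℚ) - (0 : ℕ)) /
          (∏ s ∈ Finset.range (2 ^ n), d s : ℕ) :=
      .of_nat (.mk (computable_coveredCells hR hd hp hw hDn .fst .snd)) (.mk (.const 0)) hDn
        fun m n => Finset.prod_pos fun s _ => hd0 s
    refine ⟨_, hq, fun m n => ?_⟩
    have e2 : ((((coveredCells R d p w (∏ s ∈ Finset.range (2 ^ n), d s) m n : ℚ) - (0 : ℕ)) /
        (∏ s ∈ Finset.range (2 ^ n), d s : ℕ) : ℚ) : ℝ) =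
        volume.real ((⋃ s ∈ Finset.Ico (2 ^ m) (2 ^ n), intervalUnion R d p w s) ∩ Icc 0 1) := by
      rw [volumeReal_stages_inter_Icc R d p w hd0 m n]
      push_cast
      rw [sub_zero]
    rw [e2]
    set E : Set ℝ := (⋃ s ∈ Finset.Ico (2 ^ m) (2 ^ n), intervalUnion R d p w s) ∩ Icc 0 1
    set G : Set ℝ := (⋃ s, intervalUnion R d p w (2 ^ m + s)) ∩ Icc 0 1
    set T : Set ℝ := ⋃ s, intervalUnion R d p w (2 ^ n + s)
    have hGfin : volume G ≠ ⊤ := ((hvol m).trans_lt ENNReal.ofReal_lt_top).ne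
    have hT := volume_tail_le (p := p) h (S := 2 ^ n) (by positivity)
    have hTfin : volume T ≠ ⊤ := (hT.trans_lt ENNReal.ofReal_lt_top).ne
    have hEG : E ⊆ G := by
      refine inter_subset_inter_left _ (iUnion₂_subset fun s hs => ?_)
      rw [Finset.mem_Ico] at hs
      refine subset_iUnion_of_subset (s - 2 ^ m) ?_
      rw [Nat.add_sub_cancel' hs.1]
    have hGE : G ⊆ E ∪ T := by
      rintro x ⟨hx, hx01⟩
      obtain ⟨s, hs⟩ := mem_iUnion.1 hx
      by_cases hsn : 2 ^ m + s < 2 ^ n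
      · exact Or.inl ⟨mem_iUnion₂.2 ⟨2 ^ m + s, Finset.mem_Ico.2 ⟨by omega, hsn⟩, hs⟩, hx01⟩
      · refine Or.inr (mem_iUnion.2 ⟨2 ^ m + s - 2 ^ n, ?_⟩)
        rwa [Nat.add_sub_cancel' (not_lt.1 hsn)]
    have hEfin : volume E ≠ ⊤ := ne_top_of_le_ne_top hGfin (measure_mono hEG)
    have h1 : volume.real E ≤ volume.real G := measureReal_mono hEG hGfin
    have h2 : volume.real G ≤ volume.real E + volume.real T :=
      (measureReal_mono hGE (measure_union_lt_top hEfin.lt_top hTfin.lt_top).ne).trans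
        (measureReal_union_le _ _)
    have h3 : volume.real T ≤ (1 / 2 : ℝ) ^ n := by
      refine (ENNReal.toReal_le_of_le_ofReal (by positivity) hT).trans (le_of_eq ?_)
      push_cast
      rw [one_div_pow]
    rw [abs_of_nonneg (by linarith)]
    linarith

/-! ### Correlations of dilated arcs -/

/-- The centred indicator function of the arc `[0, c)` of the circle, for `0 ≤ c < 1`
(see `arcDeviation_eq`). -/
noncomputable def arcDeviation (c y : ℝ) : ℝ := Int.fract (y - c) - Int.fract y

theorem arcDeviation_eq {c : ℝ} (hc0 : 0 ≤ c) (hc1 : c < 1) (y : ℝ) :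
    arcDeviation c y = (if Int.fract y < c then 1 else 0) - c := by
  have h0 := Int.fract_nonneg y
  have h1 := Int.fract_lt_one y
  have hy := Int.floor_add_fract y
  rw [arcDeviation]
  split_ifs with h
  · have : Int.fract (y - c) = Int.fract y - c + 1 :=
      Int.fract_eq_iff.2 ⟨by linarith, by linarith, ⌊y⌋ - 1, by push_cast; linarith⟩
    linarith
  · have : Int.fract (y - c) = Int.fract y - c :=
      Int.fract_eq_iff.2 ⟨by linarith, by linarith, ⌊y⌋, by linarith⟩
    linarith

theorem abs_arcDeviation_le_one (c y : ℝ) : |arcDeviation c y| ≤ 1 := by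
  rw [arcDeviation, abs_le]
  constructor <;> linarith [Int.fract_nonneg y, Int.fract_lt_one y, Int.fract_nonneg (y - c),
    Int.fract_lt_one (y - c)]

theorem arcDeviation_add_intCast (c y : ℝ) (z : ℤ) :
    arcDeviation c (y + z) = arcDeviation c y := by
  rw [arcDeviation, arcDeviation, add_sub_right_comm, Int.fract_add_intCast, Int.fract_add_intCast]

theorem fract_intCast_add_div {A : ℕ} (hA : 0 < A) (k : ℤ) {δ : ℝ} (h0 : 0 ≤ δ) (h1 : δ < 1) :
    Int.fract (((k : ℝ) + δ) / A) = (((k % A : ℤ) : ℝ) + δ) / A := by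
  have hA' : (0 : ℝ) < A := by exact_mod_cast hA
  have e0 : (0 : ℝ) ≤ ((k % A : ℤ) : ℝ) := by
    exact_mod_cast Int.emod_nonneg k (by omega)
  have e1 : ((k % A : ℤ) : ℝ) + 1 ≤ A := by
    exact_mod_cast Int.emod_lt_of_pos k (by omega : (0 : ℤ) < A)
  refine Int.fract_eq_iff.2 ⟨by positivity, (div_lt_one hA').2 (by linarith), k / A, ?_⟩
  have : (k : ℝ) = ((k % A : ℤ) : ℝ) + A * ((k / A : ℤ) : ℝ) := by
    exact_mod_cast (Int.emod_add_mul_ediv k A).symm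
  rw [← sub_div, add_sub_add_right_eq_sub, div_eq_iff hA'.ne']
  linarith

/-- Since `B` is a unit modulo `A`, the map `s ↦ q + s * B` permutes the residues. -/
theorem sum_range_emod_of_isCoprime {A : ℕ} (hA : 0 < A) {B : ℤ} (hAB : IsCoprime B A) (q : ℤ)
    (g : ℤ → ℝ) :
    ∑ s ∈ Finset.range A, g ((q + s * B) % A) = ∑ s ∈ Finset.range A, g s := by
  have hA' : (0 : ℤ) < A := by exact_mod_cast hA
  have hnn : ∀ k : ℤ, 0 ≤ k % A := fun k => Int.emod_nonneg k hA'.ne'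
  have hlt : ∀ k : ℤ, k % A < A := fun k => Int.emod_lt_of_pos k hA'
  have hmaps : ∀ s ∈ Finset.range A, ((q + s * B) % A).toNat ∈ Finset.range A := fun s _ => by
    have := hnn (q + s * B)
    have := hlt (q + s * B)
    rw [Finset.mem_range]
    omega
  have hinj : InjOn (fun s : ℕ => ((q + s * B) % A).toNat) (Finset.range A) := by
    intro s hs s' hs' h
    simp only [Finset.coe_range, mem_Iio] at hs hs'
    have h1 : (q + s * B) % A = (q + s' * B) % A := by
      have := hnn (q + s * B)
      have := hnn (q + s' * B)
      simp only at h
      omega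
    have h2 : (A : ℤ) ∣ ((s : ℤ) - s') * B := by
      have h3 := Int.ModEq.dvd (h1 : (q + s * B) ≡ (q + s' * B) [ZMOD A])
      rw [show ((s : ℤ) - s') * B = -(q + s' * B - (q + s * B)) by ring]
      exact h3.neg_right
    have h3 := hAB.symm.dvd_of_dvd_mul_right h2
    have h4 : (s : ℤ) - s' = 0 := Int.eq_zero_of_abs_lt_dvd h3 (by rw [abs_lt]; omega)
    omega
  refine Finset.sum_nbij (fun s : ℕ => ((q + s * B) % A).toNat) hmaps hinj
    (Finset.surjOn_of_injOn_of_card_le _ hmaps hinj le_rfl) fun s _ => ?_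
  rw [Int.toNat_of_nonneg (hnn _)]

/-- A twisted form of Hermite's identity: with `A * y` split into floor and fractional part, the
floor together with `s * B` runs through all residues modulo `A`. -/
theorem sum_fract_add_mul_div {A : ℕ} (hA : 0 < A) {B : ℤ} (hAB : IsCoprime B A) (y : ℝ) :
    ∑ s ∈ Finset.range A, Int.fract (y + s * (B : ℝ) / A) =
      Int.fract (A * y) + ∑ s ∈ Finset.range A, (s : ℝ) / A := by
  have hA' : (0 : ℝ) < A := by exact_mod_cast hA
  have e : ∀ s ∈ Finset.range A, Int.fract (y + s * (B : ℝ) / A) =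
      (((⌊A * y⌋ + s * B) % A : ℤ) : ℝ) / A + Int.fract (A * y) / A := by
    intro s _
    rw [← add_div, ← fract_intCast_add_div hA _ (Int.fract_nonneg _) (Int.fract_lt_one _)]
    congr 1
    rw [eq_div_iff hA'.ne']
    push_cast
    rw [add_mul, div_mul_cancel₀ _ hA'.ne']
    linarith [Int.floor_add_fract ((A : ℝ) * y)]
  rw [Finset.sum_congr rfl e, Finset.sum_add_distrib,
    sum_range_emod_of_isCoprime hA hAB _ fun k => (k : ℝ) / A, add_comm]
  congr 1
  rw [Finset.sum_const, Finset.card_range, nsmul_eq_mul]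
  field_simp

/-- Hermite's identity is applied at `y - c` and at `y`. The constants cancel and a difference of
two fractional parts remains. -/
theorem abs_sum_arcDeviation_le_one (c : ℝ) {A : ℕ} (hA : 0 < A) {B : ℤ} (hAB : IsCoprime B A)
    (y : ℝ) : |∑ s ∈ Finset.range A, arcDeviation c (y + s * (B : ℝ) / A)| ≤ 1 := by
  have : ∑ s ∈ Finset.range A, arcDeviation c (y + s * (B : ℝ) / A) =
      Int.fract (A * (y - c)) - Int.fract (A * y) := by
    simp only [arcDeviation, Finset.sum_sub_distrib, add_sub_right_comm]
    rw [sum_fract_add_mul_div hA hAB, sum_fract_add_mul_div hA hAB]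
    ring
  rw [this, abs_le]
  constructor <;> linarith [Int.fract_nonneg (A * (y - c)), Int.fract_nonneg (A * y),
    Int.fract_lt_one (A * (y - c)), Int.fract_lt_one (A * y)]

theorem sum_range_add_of_periodic {R : ℕ} {H : ℕ → ℝ} (hH : ∀ r, H (r + R) = H r) (k : ℕ) :
    ∑ r ∈ Finset.range R, H (r + k) = ∑ r ∈ Finset.range R, H r := by
  induction k with
  | zero => rfl
  | succ k ih =>
    have h1 := Finset.sum_range_succ (fun r => H (r + k)) R
    have h2 := Finset.sum_range_succ' (fun r => H (r + k)) R
    have h3 : H (R + k) = H (0 + k) := by rw [add_comm R, hH, zero_add]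
    have h4 : ∑ r ∈ Finset.range R, H (r + (k + 1)) = ∑ r ∈ Finset.range R, H (r + 1 + k) :=
      Finset.sum_congr rfl fun r _ => by rw [add_right_comm, add_assoc]
    linarith

/-- The decorrelation estimate. The summand has period `R` in `r`, so averaging over the shifts by
multiples of `R / |a|` is free. These shifts fix the first factor and move the second through a full
coset of the multiples of `1 / A`. -/
theorem mul_abs_sum_arcDeviation_mul_le (c : ℝ) {R : ℕ} (hR : 0 < R) {a : ℤ} (b : ℤ)
    (ha : a ≠ 0) (haR : a ∣ R) :
    ((a.natAbs / a.gcd b : ℕ) : ℝ) *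
      |∑ r ∈ Finset.range R, arcDeviation c (a * r / R) * arcDeviation c (b * r / R)| ≤ R := by
  have hR' : (R : ℝ) ≠ 0 := by positivity
  have hg : 0 < a.gcd b := Int.gcd_pos_of_ne_zero_left _ ha
  obtain ⟨q, hq⟩ := Int.natAbs_dvd_natAbs.2 haR
  rw [Int.natAbs_natCast] at hq
  obtain ⟨A, hA⟩ : a.gcd b ∣ a.natAbs := Nat.gcd_dvd_left _ _
  obtain ⟨B, hB⟩ : ((a.gcd b : ℕ) : ℤ) ∣ b := Int.gcd_dvd_right _ _
  set g := a.gcd b with hgdef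
  have hA0 : 0 < A := Nat.pos_of_ne_zero fun h => ha (by simpa [h] using hA)
  have hcop : IsCoprime B A := by
    rw [Int.isCoprime_iff_gcd_eq_one, Int.gcd_comm]
    have h1 : Int.gcd ((g : ℤ) * A) (g * B) = g := by
      rw [← hB, show (g : ℤ) * A = (a.natAbs : ℤ) by rw [hA]; push_cast; rfl]
      rw [Int.gcd, Int.natAbs_natCast]
      rfl
    rw [Int.gcd_mul_left, Int.natAbs_natCast] at h1
    exact Nat.eq_of_mul_eq_mul_left hg (by rw [h1, mul_one])
  rw [hA, Nat.mul_div_cancel_left _ hg]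
  set H : ℕ → ℝ := fun r => arcDeviation c (a * r / R) * arcDeviation c (b * r / R) with hH
  have hper : ∀ r, H (r + R) = H r := by
    intro r
    have e : ∀ z : ℤ, (z : ℝ) * (r + R : ℕ) / R = z * r / R + z := fun z => by
      push_cast; field_simp
    simp only [hH, e, arcDeviation_add_intCast]
  have hshift : ∀ t r : ℕ, H (r + q * t) =
      arcDeviation c (a * r / R) * arcDeviation c (b * r / R + t * (B : ℝ) / A) := by
    intro t r
    have hRr : (R : ℝ) = a.natAbs * q := by exact_mod_cast hq
    have hq0 : (q : ℝ) ≠ 0 := right_ne_zero_of_mul (hRr ▸ hR')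
    have hgr : (g : ℝ) ≠ 0 := by positivity
    have hAr : (A : ℝ) ≠ 0 := by positivity
    -- As `R = |a| * q`, the shift changes `a * r / R` by the integer `± t`.
    have e1 : (a : ℝ) * (r + q * t : ℕ) / R = a * r / R + ((a.sign * t : ℤ) : ℝ) := by
      have hs : (a : ℝ) = a.sign * a.natAbs := by
        rw [← Int.cast_natCast (R := ℝ) a.natAbs, ← Int.cast_mul, Int.sign_mul_natAbs]
      have hn : (a.natAbs : ℝ) ≠ 0 := left_ne_zero_of_mul (hRr ▸ hR')
      push_cast
      rw [mul_add, add_div]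
      congr 1
      rw [hRr]
      nth_rewrite 1 [hs]
      field_simp
    have e2 : (b : ℝ) * (r + q * t : ℕ) / R = b * r / R + t * (B : ℝ) / A := by
      have hn : (a.natAbs : ℝ) = g * A := by exact_mod_cast hA
      have hb : (b : ℝ) = g * B := by exact_mod_cast hB
      push_cast
      rw [mul_add, add_div]
      congr 1
      rw [hRr, hn, hb]
      field_simp
    simp only [hH, e1, e2, arcDeviation_add_intCast]
  have key : (A : ℝ) * ∑ r ∈ Finset.range R, H r = ∑ r ∈ Finset.range R,
      arcDeviation c (a * r / R) *
        ∑ t ∈ Finset.range A, arcDeviation c (b * r / R + t * (B : ℝ) / A) := by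
    have : (A : ℝ) * ∑ r ∈ Finset.range R, H r =
        ∑ t ∈ Finset.range A, ∑ r ∈ Finset.range R, H (r + q * t) := by
      simp only [sum_range_add_of_periodic hper, Finset.sum_const, Finset.card_range,
        nsmul_eq_mul]
    rw [this, Finset.sum_comm]
    simp only [hshift, Finset.mul_sum]
  have habs := abs_mul (A : ℝ) (∑ r ∈ Finset.range R, H r)
  rw [abs_of_nonneg (Nat.cast_nonneg A : (0 : ℝ) ≤ A)] at habs
  rw [← habs, key]
  refine (Finset.abs_sum_le_sum_abs _ _).trans ((Finset.sum_le_card_nsmul _ _ 1 ?_).trans (by simp))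
  intro r _
  rw [abs_mul]
  exact mul_le_one₀ (abs_arcDeviation_le_one _ _) (abs_nonneg _)
    (abs_sum_arcDeviation_le_one c hA0 hcop _)

/-! ### Counting by height and the second moment -/

/-- The fraction `b / a` has height at most `m`. -/
def HeightLE (m : ℕ) (a b : ℤ) : Prop := a.natAbs / a.gcd b ≤ m ∧ b.natAbs / a.gcd b ≤ m

instance (m : ℕ) (a b : ℤ) : Decidable (HeightLE m a b) := inferInstanceAs (Decidable (_ ∧ _))

/-- For fixed `a ≠ 0` the reduced denominator determines the gcd, and then the reduced numerator
determines `b`. -/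
theorem card_filter_heightLE_le (m : ℕ) {a : ℤ} (ha : a ≠ 0) (T : Finset ℤ) :
    (T.filter (HeightLE m a)).card ≤ (m + 1) * (2 * m + 1) := by
  have hcard : (Finset.range (m + 1) ×ˢ Finset.Icc (-(m : ℤ)) m).card = (m + 1) * (2 * m + 1) := by
    rw [Finset.card_product, Finset.card_range, Int.card_Icc]
    congr 1
    omega
  rw [← hcard]
  refine Finset.card_le_card_of_injOn (fun b => (a.natAbs / a.gcd b, b / (a.gcd b : ℤ))) ?_ ?_
  · intro b hb
    obtain ⟨-, h1, h2⟩ := Finset.mem_filter.1 hb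
    have h3 : (b / (a.gcd b : ℤ)).natAbs ≤ m := by
      rwa [Int.natAbs_ediv_of_dvd (Int.gcd_dvd_right _ _), Int.natAbs_natCast]
    simp only [Finset.coe_product, mem_prod, Finset.mem_coe, Finset.mem_range, Finset.mem_Icc]
    omega
  · intro b _ b' _ h
    simp only [Prod.mk.injEq] at h
    obtain ⟨h1, h2⟩ := h
    have e1 : a.natAbs / a.gcd b * a.gcd b = a.natAbs := Nat.div_mul_cancel (Nat.gcd_dvd_left _ _)
    have e2 : a.natAbs / a.gcd b' * a.gcd b' = a.natAbs :=
      Nat.div_mul_cancel (Nat.gcd_dvd_left _ _)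
    have hpos : 0 < a.natAbs / a.gcd b :=
      Nat.pos_of_ne_zero fun h => by simp [h] at e1; exact ha (Int.natAbs_eq_zero.1 e1.symm)
    have hg : a.gcd b = a.gcd b' :=
      Nat.eq_of_mul_eq_mul_left hpos (by rw [e1, h1, e2])
    rw [← Int.ediv_mul_cancel (Int.gcd_dvd_right a b), h2, hg,
      Int.ediv_mul_cancel (Int.gcd_dvd_right a b')]

/-- Height above `m` means that one of the two reduced entries exceeds `m`, and the decorrelation
estimate applies with that one first; otherwise the trivial bound is used. -/
theorem abs_sum_arcDeviation_mul_le (c : ℝ) {R m : ℕ} (hR : 0 < R) (hm : 0 < m) {a b : ℤ}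
    (ha : a ≠ 0 → a ∣ R) (hb : b ≠ 0 → b ∣ R) :
    |∑ r ∈ Finset.range R, arcDeviation c (a * r / R) * arcDeviation c (b * r / R)| ≤
      R * ((if HeightLE m a b then 1 else 0) + 1 / m) := by
  have hm' : (0 : ℝ) < m := by exact_mod_cast hm
  have aux : ∀ a b : ℤ, (a ≠ 0 → a ∣ R) → m < a.natAbs / a.gcd b →
      |∑ r ∈ Finset.range R, arcDeviation c (a * r / R) * arcDeviation c (b * r / R)| ≤
        R * (1 / m) := by
    intro a b ha h
    have ha0 : a ≠ 0 := by rintro rfl; simp at h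
    have := mul_abs_sum_arcDeviation_mul_le c hR b ha0 (ha ha0)
    rw [mul_one_div, le_div_iff₀ hm', mul_comm]
    exact (mul_le_mul_of_nonneg_right (by exact_mod_cast h.le) (abs_nonneg _)).trans this
  split_ifs with h
  · refine (Finset.abs_sum_le_sum_abs _ _).trans
      ((Finset.sum_le_card_nsmul _ _ 1 fun r _ => ?_).trans ?_)
    · rw [abs_mul]
      exact mul_le_one₀ (abs_arcDeviation_le_one _ _) (abs_nonneg _) (abs_arcDeviation_le_one _ _)
    · rw [Finset.card_range, nsmul_eq_mul]
      gcongr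
      have : 0 ≤ 1 / (m : ℝ) := by positivity
      linarith
  · rw [zero_add]
    rw [HeightLE, not_and_or, not_le, not_le] at h
    rcases h with h | h
    · exact aux a b ha h
    · rw [Int.gcd_comm] at h
      simpa only [mul_comm] using aux b a hb h

theorem sum_sq_sum_arcDeviation_le (c : ℝ) {R m : ℕ} (hR : 0 < R) (hm : 0 < m) {a : ℕ → ℤ}
    (ha : Function.Injective a) (haR : ∀ j < m ^ 3, a j ≠ 0 → a j ∣ R) :
    ∑ r ∈ Finset.range R, (∑ j ∈ Finset.range (m ^ 3), arcDeviation c (a j * r / R)) ^ 2 ≤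
      8 * R * (m : ℝ) ^ 5 := by
  have hm' : (1 : ℝ) ≤ m := by exact_mod_cast hm
  have e : ∑ r ∈ Finset.range R, (∑ j ∈ Finset.range (m ^ 3), arcDeviation c (a j * r / R)) ^ 2 =
      ∑ j ∈ Finset.range (m ^ 3), ∑ k ∈ Finset.range (m ^ 3), ∑ r ∈ Finset.range R,
        arcDeviation c (a j * r / R) * arcDeviation c (a k * r / R) := by
    simp only [sq, Finset.sum_mul_sum]
    rw [Finset.sum_comm]
    exact Finset.sum_congr rfl fun _ _ => Finset.sum_comm
  have hrow : ∀ j ∈ Finset.range (m ^ 3), ∑ k ∈ Finset.range (m ^ 3),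
      ((if HeightLE m (a j) (a k) then 1 else 0) + 1 / m : ℝ) ≤
        6 * m ^ 2 + m ^ 2 + if a j = 0 then (m : ℝ) ^ 3 else 0 := by
    intro j _
    rw [Finset.sum_add_distrib, Finset.sum_const, Finset.card_range, nsmul_eq_mul]
    have e1 : ((m ^ 3 : ℕ) : ℝ) * (1 / m) = m ^ 2 := by push_cast; field_simp
    have e2 : ∑ k ∈ Finset.range (m ^ 3), (if HeightLE m (a j) (a k) then 1 else 0 : ℝ) =
        (((Finset.range (m ^ 3)).filter fun k => HeightLE m (a j) (a k)).card : ℝ) := by simp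
    rw [e1, e2]
    split_ifs with h0
    -- Every `b` has height at most `1` relative to `a = 0`, so this row gets only the trivial
    -- bound. By injectivity there is at most one such row.
    · have : (((Finset.range (m ^ 3)).filter fun k => HeightLE m (a j) (a k)).card : ℝ) ≤
          (m : ℝ) ^ 3 := by
        exact_mod_cast (Finset.card_filter_le _ _).trans (by simp)
      nlinarith [sq_nonneg (m : ℝ)]
    · have h1 : ((Finset.range (m ^ 3)).filter fun k => HeightLE m (a j) (a k)).card ≤
          (m + 1) * (2 * m + 1) := by
        refine le_trans (le_of_eq ?_)
          (card_filter_heightLE_le m h0 ((Finset.range (m ^ 3)).map ⟨a, ha⟩))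
        rw [Finset.filter_map, Finset.card_map]
        rfl
      have h2 : (((Finset.range (m ^ 3)).filter fun k => HeightLE m (a j) (a k)).card : ℝ) ≤
          (m + 1) * (2 * m + 1) := by exact_mod_cast h1
      nlinarith
  have hzero : ∑ j ∈ Finset.range (m ^ 3), (if a j = 0 then (m : ℝ) ^ 3 else 0) ≤ m ^ 3 := by
    rw [← Finset.sum_filter, Finset.sum_const, nsmul_eq_mul]
    have : ((Finset.range (m ^ 3)).filter fun j => a j = 0).card ≤ 1 :=
      Finset.card_le_one.2 fun i hi k hk =>
        ha ((Finset.mem_filter.1 hi).2.trans (Finset.mem_filter.1 hk).2.symm)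
    exact mul_le_of_le_one_left (by positivity) (by exact_mod_cast this)
  calc _ ≤ ∑ j ∈ Finset.range (m ^ 3), ∑ k ∈ Finset.range (m ^ 3),
        R * ((if HeightLE m (a j) (a k) then 1 else 0) + 1 / m : ℝ) := by
        rw [e]
        refine Finset.sum_le_sum fun j hj => Finset.sum_le_sum fun k hk => ?_
        exact (le_abs_self _).trans (abs_sum_arcDeviation_mul_le c hR hm
          (haR j (Finset.mem_range.1 hj)) (haR k (Finset.mem_range.1 hk)))
    _ ≤ R * ∑ j ∈ Finset.range (m ^ 3),
        (6 * (m : ℝ) ^ 2 + m ^ 2 + if a j = 0 then (m : ℝ) ^ 3 else 0) := by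
        simp only [← Finset.mul_sum]
        gcongr with j hj
        exact hrow j hj
    _ ≤ R * (7 * m ^ 5 + m ^ 3) := by
        rw [Finset.sum_add_distrib, Finset.sum_const, Finset.card_range, nsmul_eq_mul]
        refine mul_le_mul_of_nonneg_left (add_le_add (le_of_eq ?_) hzero) (Nat.cast_nonneg R)
        push_cast
        ring
    _ ≤ 8 * R * (m : ℝ) ^ 5 := by
        have : (m : ℝ) ^ 3 ≤ m ^ 5 := pow_le_pow_right₀ hm' (by norm_num)
        nlinarith [(Nat.cast_nonneg R : (0 : ℝ) ≤ R)]

/-- Chebyshev's inequality: `8 R m ^ 5` divided by `(m ^ 3 / L) ^ 2`. -/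
theorem card_filter_abs_sum_arcDeviation_le (c : ℝ) {R m L : ℕ} (hR : 0 < R) (hm : 0 < m)
    (hL : 0 < L) {a : ℕ → ℤ} (ha : Function.Injective a)
    (haR : ∀ j < m ^ 3, a j ≠ 0 → a j ∣ R) (P : ℕ → Prop) [DecidablePred P]
    (hP : ∀ r < R, P r →
      (m : ℝ) ^ 3 / L ≤ |∑ j ∈ Finset.range (m ^ 3), arcDeviation c (a j * r / R)|) :
    (((Finset.range R).filter P).card : ℝ) ≤ 8 * R * L ^ 2 / m := by
  have hm' : (0 : ℝ) < m := by exact_mod_cast hm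
  have hL' : (0 : ℝ) < L := by exact_mod_cast hL
  have h1 : (((Finset.range R).filter P).card : ℝ) * ((m : ℝ) ^ 3 / L) ^ 2 ≤
      8 * R * (m : ℝ) ^ 5 := by
    refine le_trans ?_ (sum_sq_sum_arcDeviation_le c hR hm ha haR)
    rw [← nsmul_eq_mul]
    refine (Finset.card_nsmul_le_sum _
      (fun r : ℕ => (∑ j ∈ Finset.range (m ^ 3), arcDeviation c (a j * r / R)) ^ 2) _ ?_).trans
      (Finset.sum_le_sum_of_subset_of_nonneg (Finset.filter_subset _ _) fun _ _ _ => sq_nonneg _)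
    intro r hr
    obtain ⟨hr1, hr2⟩ := Finset.mem_filter.1 hr
    have := hP r (Finset.mem_range.1 hr1) hr2
    rw [← sq_abs (∑ j ∈ Finset.range (m ^ 3), _)]
    gcongr
  rw [le_div_iff₀ hm']
  rw [div_pow, mul_div_assoc', div_le_iff₀ (by positivity)] at h1
  refine le_of_mul_le_mul_right ?_ (by positivity : (0 : ℝ) < (m : ℝ) ^ 5)
  linarith

/-! ### Reduction of uniform distribution to rational arcs -/

/-- The proportion of the indices `j < n` for which the fractional part of `y j` is below `c`. -/
noncomputable def freqBelow (y : ℕ → ℝ) (c : ℝ) (n : ℕ) : ℝ :=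
  (((Finset.range n).filter fun j => Int.fract (y j) < c).card : ℝ) / n

theorem freqBelow_mono (y : ℕ → ℝ) (n : ℕ) {c c' : ℝ} (h : c ≤ c') :
    freqBelow y c n ≤ freqBelow y c' n := by
  unfold freqBelow
  gcongr with j

theorem freqBelow_le_one (y : ℕ → ℝ) (c : ℝ) (n : ℕ) : freqBelow y c n ≤ 1 := by
  refine div_le_one_of_le₀ ?_ (Nat.cast_nonneg n)
  exact_mod_cast (Finset.card_filter_le _ _).trans (by simp)

theorem Rat.exists_natCast_div_eq {q : ℚ} (h0 : 0 ≤ q) (h1 : q < 1) :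
    ∃ e f : ℕ, (q : ℝ) = (e : ℝ) / (e + f + 1) := by
  have hnum : (q.num.toNat : ℤ) = q.num := Int.toNat_of_nonneg (Rat.num_nonneg.2 h0)
  have hlt : q.num.toNat < q.den := by
    have : q.num < q.den := by
      have h2 := (Rat.lt_iff q 1).1 h1
      simpa using h2
    omega
  refine ⟨q.num.toNat, q.den - q.num.toNat - 1, ?_⟩
  have e1 : ((q.num.toNat : ℝ) + (q.den - q.num.toNat - 1 : ℕ) + 1) = q.den := by
    have : q.num.toNat + (q.den - q.num.toNat - 1) + 1 = q.den := by omega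
    exact_mod_cast this
  have e2 : (q.num.toNat : ℝ) = (q.num : ℝ) := by exact_mod_cast congrArg (Int.cast : ℤ → ℝ) hnum
  rw [e1, e2]
  exact Rat.cast_def q

/-- The numbers `e / (e + f + 1)` are exactly the rationals in `[0, 1)`. Monotonicity in `c` extends
the limits to real `c`, and an interval is squeezed between differences of arcs starting at `0`. -/
theorem uniformlyDistributedModOne_of_freqBelow {y : ℕ → ℝ}
    (h : ∀ e f : ℕ, Tendsto (freqBelow y ((e : ℝ) / (e + f + 1))) atTop
      (𝓝 ((e : ℝ) / (e + f + 1)))) :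
    UniformlyDistributedModOne y := by
  have lower : ∀ c : ℝ, c ≤ 1 → ∀ ε > 0, ∀ᶠ n in atTop, c - ε < freqBelow y c n := by
    intro c hc ε hε
    by_cases hcε : c - ε < 0
    · exact Eventually.of_forall fun n => hcε.trans_le (by unfold freqBelow; positivity)
    · obtain ⟨q, hq1, hq2⟩ := exists_rat_btwn (sub_lt_self c hε)
      obtain ⟨e, f, hef⟩ := Rat.exists_natCast_div_eq (q := q)
        (by exact_mod_cast (not_lt.1 hcε).trans hq1.le) (by exact_mod_cast hq2.trans_le hc)
      rw [hef] at hq1 hq2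
      filter_upwards [(h e f).eventually_const_lt hq1] with n hn
      exact hn.trans_le (freqBelow_mono y n hq2.le)
  have upper : ∀ c : ℝ, 0 ≤ c → ∀ ε > 0, ∀ᶠ n in atTop, freqBelow y c n < c + ε := by
    intro c hc ε hε
    by_cases hcε : 1 < c + ε
    · exact Eventually.of_forall fun n => (freqBelow_le_one y c n).trans_lt hcε
    · obtain ⟨q, hq1, hq2⟩ := exists_rat_btwn (lt_add_of_pos_right c hε)
      obtain ⟨e, f, hef⟩ := Rat.exists_natCast_div_eq (q := q)
        (by exact_mod_cast hc.trans hq1.le) (by exact_mod_cast hq2.trans_le (not_lt.1 hcε))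
      rw [hef] at hq1 hq2
      filter_upwards [(h e f).eventually_lt_const hq2] with n hn
      exact (freqBelow_mono y n hq1.le).trans_lt hn
  intro I hI hI01
  classical
  have hcount : ∀ n : ℕ, {i : ℕ | i < n ∧ Int.fract (y i) ∈ I}.ncard =
      ((Finset.range n).filter fun i => Int.fract (y i) ∈ I).card := fun n => by
    rw [← Set.ncard_coe_finset]
    congr 1
    ext i
    simp
  simp only [hcount]
  rcases I.eq_empty_or_nonempty with rfl | hne
  · simp
  have hbb : BddBelow I := ⟨0, fun z hz => (hI01 hz).1⟩
  have hba : BddAbove I := ⟨1, fun z hz => (hI01 hz).2⟩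
  set u := sInf I with hu
  set v := sSup I with hv
  have hIcc : I ⊆ Icc u v := fun z hz => ⟨csInf_le hbb hz, le_csSup hba hz⟩
  have hIoo : Ioo u v ⊆ I := fun z hz => by
    obtain ⟨p, hp, hpz⟩ := exists_lt_of_csInf_lt hne hz.1
    obtain ⟨q, hq, hqz⟩ := exists_lt_of_lt_csSup hne hz.2
    exact hI.out hp hq ⟨hpz.le, hqz.le⟩
  have hu0 : 0 ≤ u := le_csInf hne fun z hz => (hI01 hz).1
  have hv1 : v ≤ 1 := csSup_le hne fun z hz => (hI01 hz).2
  have huv : u ≤ v := by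
    obtain ⟨z, hz⟩ := hne
    exact (hIcc hz).1.trans (hIcc hz).2
  have hvol : volume.real I = v - u := by
    refine le_antisymm ?_ ?_
    · rw [← Real.volume_real_Icc_of_le huv]
      exact measureReal_mono hIcc measure_Icc_lt_top.ne
    · rw [← Real.volume_real_Ioo_of_le huv]
      exact measureReal_mono hIoo (ne_top_of_le_ne_top measure_Icc_lt_top.ne (measure_mono hIcc))
  rw [hvol, Metric.tendsto_nhds]
  intro ε hε
  -- The shifts by `ε / 4` absorb the endpoints: `freqBelow` uses a strict inequality, whereas `I`
  -- may contain `v` or omit `u`.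
  filter_upwards [upper (v + ε / 4) (by linarith) (ε / 4) (by linarith),
    lower u (huv.trans hv1) (ε / 4) (by linarith), lower v hv1 (ε / 4) (by linarith),
    upper (u + ε / 4) (by linarith) (ε / 4) (by linarith)] with n h1 h2 h3 h4
  have k1 : (((Finset.range n).filter fun i => Int.fract (y i) ∈ I).card : ℝ) / n +
      freqBelow y u n ≤ freqBelow y (v + ε / 4) n := by
    rw [freqBelow, freqBelow, ← add_div]
    gcongr
    rw [← Nat.cast_add, ← Finset.card_union_of_disjoint, ← Finset.filter_or]
    · gcongr with i
      rintro (hi | hi)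
      · exact (hIcc hi).2.trans_lt (by linarith)
      · linarith
    · exact Finset.disjoint_filter.2 fun i _ hi => not_lt.2 (hIcc hi).1
  have k2 : freqBelow y v n ≤
      (((Finset.range n).filter fun i => Int.fract (y i) ∈ I).card : ℝ) / n +
      freqBelow y (u + ε / 4) n := by
    rw [freqBelow, freqBelow, ← add_div]
    gcongr
    rw [← Nat.cast_add]
    refine Nat.cast_le.2 (le_trans (Finset.card_le_card ?_) (Finset.card_union_le _ _))
    rw [← Finset.filter_or]
    refine Finset.monotone_filter_right _ fun i _ hi => ?_
    by_cases hi' : Int.fract (y i) < u + ε / 4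
    · exact Or.inr hi'
    · exact Or.inl (hIoo ⟨by linarith, hi⟩)
  rw [Real.dist_eq, abs_lt]
  constructor <;> linarith

/-! ### Evaluation at grid points -/

theorem sum_arcDeviation_eq {c : ℝ} (hc0 : 0 ≤ c) (hc1 : c < 1) (y : ℕ → ℝ) (n : ℕ) :
    ∑ j ∈ Finset.range n, arcDeviation c (y j) =
      (((Finset.range n).filter fun j => Int.fract (y j) < c).card : ℝ) - n * c := by
  simp [arcDeviation_eq hc0 hc1]

theorem fract_lt_div_iff_floor {e M : ℕ} (hM : 0 < M) (y : ℝ) :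
    Int.fract y < (e : ℝ) / M ↔ ⌊M * y⌋ - M * (⌊M * y⌋ / M) < e := by
  have hM' : (0 : ℝ) < M := by exact_mod_cast hM
  have h1 : ⌊(M : ℝ) * y⌋ / (M : ℤ) = ⌊y⌋ := by
    rw [← Int.floor_div_natCast, mul_div_cancel_left₀ _ hM'.ne']
  rw [h1, ← Int.self_sub_floor, lt_div_iff₀ hM', sub_lt_iff_lt_add, Int.floor_lt]
  push_cast
  constructor <;> intro h <;> linarith

/-- A jump of `⌊b * x⌋` inside the cell would put the integer `k * q`, where `Q = b * q`, strictly
between `n` and `n + 1`. Both signs of `q` occur. -/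
theorem floor_mul_le_of_cell {b : ℤ} {Q : ℕ} (hb : b ≠ 0 → b ∣ Q) {n : ℕ} {x z : ℝ}
    (hx : (n : ℝ) < x * Q ∧ x * Q < n + 1) (hz : (n : ℝ) < z * Q ∧ z * Q < n + 1) :
    ⌊b * x⌋ ≤ ⌊b * z⌋ := by
  by_contra! h
  set k := ⌊(b : ℝ) * x⌋
  have h1 : (b : ℝ) * z < k := Int.floor_lt.1 h
  have h2 : (k : ℝ) ≤ b * x := Int.floor_le _
  have hb0 : b ≠ 0 := by rintro rfl; simp at h1 h2; linarith
  obtain ⟨q, hq⟩ := hb hb0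
  have hqr : (Q : ℝ) = b * q := by exact_mod_cast hq
  rw [hqr, show x * (b * q : ℝ) = b * x * q by ring] at hx
  rw [hqr, show z * (b * q : ℝ) = b * z * q by ring] at hz
  obtain ⟨e1, e2⟩ : (n : ℝ) < k * q ∧ (k : ℝ) * q < n + 1 := by
    rcases le_total (q : ℝ) 0 with hq0 | hq0
    · exact ⟨hx.1.trans_le (mul_le_mul_of_nonpos_right h2 hq0),
        (mul_le_mul_of_nonpos_right h1.le hq0).trans_lt hz.2⟩
    · exact ⟨hz.1.trans_le (mul_le_mul_of_nonneg_right h1.le hq0),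
        (mul_le_mul_of_nonneg_right h2 hq0).trans_lt hx.2⟩
  have e1' : (n : ℤ) < k * q := by exact_mod_cast e1
  have e2' : k * q < (n : ℤ) + 1 := by exact_mod_cast e2
  omega

theorem fract_lt_div_iff_of_cell {e M : ℕ} (hM : 0 < M) {b : ℤ} {Q : ℕ}
    (hb : b ≠ 0 → M * b ∣ Q) {n : ℕ} {x z : ℝ}
    (hx : (n : ℝ) < x * Q ∧ x * Q < n + 1) (hz : (n : ℝ) < z * Q ∧ z * Q < n + 1) :
    Int.fract (b * x) < (e : ℝ) / M ↔ Int.fract (b * z) < (e : ℝ) / M := by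
  have hb' : (M : ℤ) * b ≠ 0 → (M : ℤ) * b ∣ Q := fun h => hb (right_ne_zero_of_mul h)
  have : ⌊(M : ℝ) * (b * x)⌋ = ⌊(M : ℝ) * (b * z)⌋ := by
    have h1 := floor_mul_le_of_cell hb' hx hz
    have h2 := floor_mul_le_of_cell hb' hz hx
    push_cast at h1 h2
    rw [mul_assoc, mul_assoc] at h1 h2
    exact le_antisymm h1 h2
  rw [fract_lt_div_iff_floor hM, fract_lt_div_iff_floor hM, this]

/-- Since `R - 1` is `-1` modulo `R`, a negative `b` is replaced by a natural number in the same
residue class, and the condition becomes one in `ℕ`. -/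
theorem fract_int_mul_div_lt_iff {R : ℕ} (hR : 0 < R) {e M : ℕ} (hM : 0 < M) (b : ℤ) (r : ℕ) :
    Int.fract ((b : ℝ) * r / R) < (e : ℝ) / M ↔
      (b.toNat + (R - 1) * (-b).toNat) * r % R * M < e * R := by
  have hR' : (0 : ℝ) < R := by exact_mod_cast hR
  have hM' : (0 : ℝ) < M := by exact_mod_cast hM
  have h1 : (((b.toNat + (R - 1) * (-b).toNat) * r : ℕ) : ℤ) = b * r + R * ((-b).toNat * r) := by
    have : (b.toNat : ℤ) - (-b).toNat = b := by omega
    rw [Nat.cast_mul, Nat.cast_add, Nat.cast_mul, Nat.cast_sub hR]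
    nth_rewrite 3 [← this]
    push_cast
    ring
  have h2 : (((b.toNat + (R - 1) * (-b).toNat) * r % R : ℕ) : ℤ) = b * r % R := by
    rw [Int.natCast_mod, h1, Int.add_mul_emod_self_left]
  have h3 : Int.fract ((b : ℝ) * r / R) =
      (((b.toNat + (R - 1) * (-b).toNat) * r % R : ℕ) : ℝ) / R := by
    rw [← Int.cast_natCast (_ % R), h2]
    have := Int.fract_div_intCast_eq_div_intCast_mod (k := ℝ) (m := b * r) (n := R)
    push_cast at this ⊢
    exact this
  rw [h3, div_lt_div_iff₀ hR' hM']
  exact_mod_cast Iff.rfl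

/-- The budget, in units of `1 / L ^ 4`: `1/2` for the bad points among the first `R`, `1/6` for the
extra endpoint `r = R` (this uses `12 * L ^ 4 ≤ R`), and `1/3` for the tiny intervals around all
grid points. -/
theorem sum_two_mul_radius_le (c : ℝ) {R L : ℕ} (hL : 0 < L) (hWR : 12 * L ^ 4 ≤ R) {a : ℕ → ℤ}
    (ha : Function.Injective a) (haR : ∀ j < (32 * L ^ 6) ^ 3, a j ≠ 0 → a j ∣ R) (P : ℕ → Prop)
    [DecidablePred P] (hP : ∀ r < R, P r → ((32 * L ^ 6 : ℕ) : ℝ) ^ 3 / L ≤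
      |∑ j ∈ Finset.range ((32 * L ^ 6) ^ 3), arcDeviation c (a j * r / R)|) :
    ∑ r ∈ Finset.range (R + 1),
      2 * ((12 * L ^ 4 * (if P r then 1 else 0) + 1 : ℕ) : ℝ) / (R * (12 * L ^ 4) : ℕ) ≤
        1 / (L : ℝ) ^ 4 := by
  have hL' : (0 : ℝ) < L := by exact_mod_cast hL
  have hW : 0 < 12 * L ^ 4 := by positivity
  have hR : 0 < R := hW.trans_le hWR
  have hR' : (0 : ℝ) < R := by exact_mod_cast hR
  have hR1 : (1 : ℝ) ≤ R := by exact_mod_cast hR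
  have hWR' : 12 * (L : ℝ) ^ 4 ≤ R := by exact_mod_cast hWR
  have hcard := card_filter_abs_sum_arcDeviation_le c hR (m := 32 * L ^ 6) (by positivity) hL ha
    haR P hP
  have hcard' : (((Finset.range (R + 1)).filter P).card : ℝ) ≤
      ((Finset.range R).filter P).card + 1 := by
    rw [Finset.range_add_one, Finset.filter_insert]
    split_ifs
    · exact_mod_cast Finset.card_insert_le _ _
    · linarith
  have hsum : ∑ r ∈ Finset.range (R + 1),
      2 * ((12 * L ^ 4 * (if P r then 1 else 0) + 1 : ℕ) : ℝ) / (R * (12 * L ^ 4) : ℕ) =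
      2 * ((Finset.range (R + 1)).filter P).card / R + (R + 1) / (6 * R * L ^ 4) := by
    rw [← Finset.sum_div, ← Finset.mul_sum]
    push_cast
    rw [Finset.sum_add_distrib, ← Finset.mul_sum, Finset.sum_boole, Finset.sum_const,
      Finset.card_range, nsmul_eq_mul]
    push_cast
    field_simp
    ring
  rw [hsum]
  have e1 : 2 * (((Finset.range (R + 1)).filter P).card : ℝ) / R ≤
      1 / (2 * L ^ 4) + 1 / (6 * L ^ 4) := by
    calc 2 * (((Finset.range (R + 1)).filter P).card : ℝ) / R
        ≤ 2 * (8 * R * L ^ 2 / (32 * L ^ 6 : ℕ) + 1) / R := by gcongr; linarith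
      _ = 1 / (2 * L ^ 4) + 2 / R := by push_cast; field_simp; ring
      _ ≤ 1 / (2 * L ^ 4) + 2 / (12 * L ^ 4) := by gcongr
      _ = _ := by field_simp; ring
  have e2 : ((R : ℝ) + 1) / (6 * R * L ^ 4) ≤ (R + R) / (6 * R * L ^ 4) := by gcongr
  have e3 : ((R : ℝ) + R) / (6 * R * L ^ 4) = 1 / (3 * L ^ 4) := by field_simp; ring
  have e4 : 1 / (2 * (L : ℝ) ^ 4) + 1 / (6 * L ^ 4) + 1 / (3 * L ^ 4) = 1 / L ^ 4 := by
    field_simp; norm_num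
  linarith

/-- If `x` avoids all grid points and all cells around bad grid points, then the deviation at `x`
is the deviation at a good grid point. -/
theorem exists_grid_point_sum_arcDeviation_eq {x : ℝ} (hx : x ∈ Icc (0 : ℝ) 1) {e M Q : ℕ}
    (heM : e < M) (hQ : 0 < Q) (hgrid : ∀ r ≤ 2 * Q, x ≠ (r : ℝ) / (2 * Q : ℕ)) {a : ℕ → ℤ}
    {n : ℕ} (ha : ∀ j < n, a j ≠ 0 → M * a j ∣ Q) :
    ∃ r ≤ 2 * Q, |x - r / (2 * Q : ℕ)| < 1 / (2 * Q : ℕ) ∧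
      ∑ j ∈ Finset.range n, arcDeviation ((e : ℝ) / M) (a j * x) =
        ∑ j ∈ Finset.range n, arcDeviation ((e : ℝ) / M) (a j * r / (2 * Q : ℕ)) := by
  have hQ' : (0 : ℝ) < Q := by exact_mod_cast hQ
  have hM : 0 < M := by omega
  have hM' : (0 : ℝ) < M := by exact_mod_cast hM
  have hne : ∀ k ≤ Q, (k : ℝ) ≠ x * Q := fun k hk h => hgrid (2 * k) (by omega) (by
    push_cast
    rw [h]
    field_simp)
  have hxQ : x * Q ≤ Q := by nlinarith [hx.2]
  have hk : ⌊x * Q⌋₊ ≤ Q := by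
    exact_mod_cast (Nat.floor_le (mul_nonneg hx.1 hQ'.le)).trans hxQ
  have h1 : (⌊x * Q⌋₊ : ℝ) < x * Q :=
    lt_of_le_of_ne (Nat.floor_le (mul_nonneg hx.1 hQ'.le)) (hne _ hk)
  have h2 : x * Q < (⌊x * Q⌋₊ : ℝ) + 1 := Nat.lt_floor_add_one _
  set k := ⌊x * Q⌋₊
  have hkQ : k < Q := by exact_mod_cast h1.trans_le hxQ
  have hmid : ((2 * k + 1 : ℕ) : ℝ) / (2 * Q : ℕ) * Q = k + 1 / 2 := by push_cast; field_simp
  refine ⟨2 * k + 1, by omega, ?_, ?_⟩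
  -- The chosen point is the midpoint of the cell of mesh `1 / Q` containing `x`; this is why the
  -- grid is refined by a factor of `2`.
  · have h2Q : (0 : ℝ) < (2 * Q : ℕ) := by positivity
    rw [lt_div_iff₀ h2Q, ← abs_of_pos h2Q, ← abs_mul, abs_of_pos h2Q, sub_mul,
      div_mul_cancel₀ _ h2Q.ne', abs_lt]
    push_cast
    constructor <;> linarith
  · refine Finset.sum_congr rfl fun j hj => ?_
    have hc0 : (0 : ℝ) ≤ (e : ℝ) / M := by positivity
    have hc1 : (e : ℝ) / M < 1 := (div_lt_one hM').2 (by exact_mod_cast heM)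
    rw [arcDeviation_eq hc0 hc1, arcDeviation_eq hc0 hc1, mul_div_assoc]
    congr 1
    exact if_congr (fract_lt_div_iff_of_cell hM (ha j (Finset.mem_range.1 hj)) ⟨h1, h2⟩
      (by rw [hmid]; constructor <;> linarith)) rfl rfl

/-! ### The stages and their computability -/

/-! Stage `s` of the test concerns the sequence `a (seqIndex s)` and the arc `[0, c)` with
`c = arcNum s / arcDen s`. -/

/-- The index of the sequence tested at stage `s`. -/
def seqIndex (s : ℕ) : ℕ := s.unpair.1.unpair.1

/-- The numerator of the length of the arc tested at stage `s`. -/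
def arcNum (s : ℕ) : ℕ := s.unpair.1.unpair.2.unpair.1

/-- The denominator of the length of the arc tested at stage `s`. -/
def arcDen (s : ℕ) : ℕ := arcNum s + s.unpair.1.unpair.2.unpair.2 + 1

/-- The inverse of the deviation tolerated at stage `s`. -/
def stageLevel (s : ℕ) : ℕ := s.unpair.1 + s.unpair.2 + 1

/-- The number of terms examined at stage `s`. -/
def stageLength (s : ℕ) : ℕ := (32 * stageLevel s ^ 6) ^ 3

/-- The inverse mesh of a grid containing all jumps of the counting function of stage `s`. -/
def stageMesh (a : ℕ → ℕ → ℤ) (s : ℕ) : ℕ :=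
  arcDen s * (12 * stageLevel s ^ 4) * ∏ j ∈ Finset.range (stageLength s),
    max 1 ((a (seqIndex s) j).toNat + (-a (seqIndex s) j).toNat)

/-- The number of the terms examined at stage `s` that send the point `r / (2 * stageMesh a s)`
into the arc of that stage. -/
def stageHits (a : ℕ → ℕ → ℤ) (s r : ℕ) : ℕ :=
  ∑ j ∈ Finset.range (stageLength s),
    if ((a (seqIndex s) j).toNat + (2 * stageMesh a s - 1) * (-a (seqIndex s) j).toNat) * r %
      (2 * stageMesh a s) * arcDen s < arcNum s * (2 * stageMesh a s) then 1 else 0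

/-- The point `r / (2 * stageMesh a s)` has a large deviation at stage `s`. -/
def StageBad (a : ℕ → ℕ → ℤ) (s r : ℕ) : Prop :=
  stageHits a s r * arcDen s * stageLevel s + stageLength s * arcDen s ≤
      arcNum s * stageLength s * stageLevel s ∨
    arcNum s * stageLength s * stageLevel s + stageLength s * arcDen s ≤
      stageHits a s r * arcDen s * stageLevel s

instance (a : ℕ → ℕ → ℤ) (s r : ℕ) : Decidable (StageBad a s r) :=
  inferInstanceAs (Decidable (_ ∨ _))

/-- The radius, in units of the reciprocal of `2 * stageMesh a s * (12 * stageLevel s ^ 4)`, of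
the interval around `r / (2 * stageMesh a s)` contributed by stage `s`. -/
def stageRadius (a : ℕ → ℕ → ℤ) (s r : ℕ) : ℕ :=
  12 * stageLevel s ^ 4 * (if StageBad a s r then 1 else 0) + 1

theorem computable_seqIndex : Computable seqIndex := .unpair_fst (.unpair_fst .id)

theorem computable_arcNum : Computable arcNum := .unpair_fst (.unpair_snd (.unpair_fst .id))

theorem computable_arcDen : Computable arcDen :=
  .natAdd (.natAdd computable_arcNum (.unpair_snd (.unpair_snd (.unpair_fst .id)))) (.const 1)

theorem computable_stageLevel : Computable stageLevel :=
  .natAdd (.natAdd (.unpair_fst .id) (.unpair_snd .id)) (.const 1)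

theorem computable_stageLength : Computable stageLength :=
  .natPow (.natMul (.const 32) (.natPow computable_stageLevel (.const 6))) (.const 3)

attribute [irreducible] stageLevel stageLength

theorem computable_stageMesh {a : ℕ → ℕ → ℤ} (ha : Computable₂ a) : Computable (stageMesh a) := by
  have h : Computable₂ fun s j : ℕ => a (seqIndex s) j :=
    .mk (ha.comp (computable_seqIndex.comp .fst) .snd)
  exact .natMul (.natMul computable_arcDen (.natMul (.const 12)
    (.natPow computable_stageLevel (.const 4)))) (.prod_range (.mk (.natMax (.const 1)
      (.natAdd (computable_int_toNat.comp h) (computable_int_neg_toNat.comp h))))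
        computable_stageLength)

attribute [irreducible] stageMesh

theorem computable_stageHits {a : ℕ → ℕ → ℤ} (ha : Computable₂ a) : Computable₂ (stageHits a) := by
  have h : Computable fun q : (ℕ × ℕ) × ℕ => a (seqIndex q.1.1) q.2 :=
    ha.comp (computable_seqIndex.comp (.comp .fst .fst)) .snd
  have hR : Computable fun q : (ℕ × ℕ) × ℕ => 2 * stageMesh a q.1.1 :=
    .natMul (.const 2) ((computable_stageMesh ha).comp (.comp .fst .fst))
  exact .mk (.sum_range (.mk (.ite_lt
    (.natMul (.natMod (.natMul (.natAdd (computable_int_toNat.comp h)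
      (.natMul (.natSub hR (.const 1)) (computable_int_neg_toNat.comp h)))
        (.comp .snd .fst)) hR) (computable_arcDen.comp (.comp .fst .fst)))
    (.natMul (computable_arcNum.comp (.comp .fst .fst)) hR)))
    (computable_stageLength.comp .fst))

theorem max_ite_one_zero (p q : Prop) [Decidable p] [Decidable q] :
    max (if p then 1 else 0) (if q then 1 else 0) = if p ∨ q then 1 else 0 := by
  by_cases hp : p <;> by_cases hq : q <;> simp [hp, hq]

theorem computable_stageRadius {a : ℕ → ℕ → ℤ} (ha : Computable₂ a) : Computable₂ (stageRadius a) := by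
  have hx : Computable fun q : ℕ × ℕ => stageHits a q.1 q.2 * arcDen q.1 * stageLevel q.1 :=
    .natMul (.natMul (computable_stageHits ha) (computable_arcDen.comp .fst))
      (computable_stageLevel.comp .fst)
  have hy : Computable fun q : ℕ × ℕ => arcNum q.1 * stageLength q.1 * stageLevel q.1 :=
    .natMul (.natMul (computable_arcNum.comp .fst) (computable_stageLength.comp .fst))
      (computable_stageLevel.comp .fst)
  have hz : Computable fun q : ℕ × ℕ => stageLength q.1 * arcDen q.1 :=
    .natMul (computable_stageLength.comp .fst) (computable_arcDen.comp .fst)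
  have hW : Computable fun q : ℕ × ℕ => 12 * stageLevel q.1 ^ 4 :=
    .natMul (.const 12) (.natPow (computable_stageLevel.comp .fst) (.const 4))
  refine (Computable.natAdd (.natMul hW (.natMax (.ite_le (.natAdd hx hz) hy)
    (.ite_le (.natAdd hy hz) hx))) (.const 1)).of_eq fun q => ?_
  rw [max_ite_one_zero]
  rfl

theorem stageLevel_pos (s : ℕ) : 0 < stageLevel s := by
  rw [stageLevel]
  exact Nat.succ_pos _

theorem arcNum_lt_arcDen (s : ℕ) : arcNum s < arcDen s := by
  rw [arcDen]
  omega

theorem stageMesh_pos (a : ℕ → ℕ → ℤ) (s : ℕ) : 0 < stageMesh a s := by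
  have := stageLevel_pos s
  have h1 := (Nat.zero_le _).trans_lt (arcNum_lt_arcDen s)
  have h2 : 0 < ∏ j ∈ Finset.range (stageLength s),
      max 1 ((a (seqIndex s) j).toNat + (-a (seqIndex s) j).toNat) :=
    Finset.prod_pos fun j _ => by positivity
  rw [stageMesh]
  positivity

theorem arcDen_mul_dvd_stageMesh (a : ℕ → ℕ → ℤ) (s : ℕ) :
    ∀ j < stageLength s, a (seqIndex s) j ≠ 0 → (arcDen s : ℤ) * a (seqIndex s) j ∣ stageMesh a s := by
  intro j hj h0
  -- The two truncated parts add up to the absolute value; the `max` matters only for a zero term,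
  -- which must not annihilate the product.
  have h1 : max 1 ((a (seqIndex s) j).toNat + (-a (seqIndex s) j).toNat) =
      (a (seqIndex s) j).natAbs := by omega
  have h2 : (a (seqIndex s) j).natAbs ∣ ∏ j ∈ Finset.range (stageLength s),
      max 1 ((a (seqIndex s) j).toNat + (-a (seqIndex s) j).toNat) :=
    h1 ▸ Finset.dvd_prod_of_mem _ (Finset.mem_range.2 hj)
  rw [← Int.natAbs_dvd_natAbs, Int.natAbs_mul, Int.natAbs_natCast, Int.natAbs_natCast, stageMesh]
  exact mul_dvd_mul (dvd_mul_right _ _) h2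

theorem dvd_two_mul_stageMesh (a : ℕ → ℕ → ℤ) (s : ℕ) :
    ∀ j < stageLength s, a (seqIndex s) j ≠ 0 → a (seqIndex s) j ∣ (2 * stageMesh a s : ℕ) := by
  intro j hj h0
  rw [Nat.cast_mul]
  exact ((dvd_mul_left _ _).trans (arcDen_mul_dvd_stageMesh a s j hj h0)).mul_left _

theorem twelve_mul_le_two_mul_stageMesh (a : ℕ → ℕ → ℤ) (s : ℕ) :
    12 * stageLevel s ^ 4 ≤ 2 * stageMesh a s := by
  refine Nat.le_of_dvd (by have := stageMesh_pos a s; omega) (Dvd.dvd.mul_left ?_ 2)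
  rw [stageMesh]
  exact (dvd_mul_left _ _).mul_right _

/-- Multiplying by `arcDen s * stageLevel s` clears the denominators, so a real inequality becomes
decidable in `ℕ`. The two disjuncts are the two signs of the deviation. -/
theorem le_abs_sum_arcDeviation_iff_stageBad (a : ℕ → ℕ → ℤ) (s r : ℕ) :
    (stageLength s : ℝ) / stageLevel s ≤ |∑ j ∈ Finset.range (stageLength s),
      arcDeviation ((arcNum s : ℝ) / arcDen s)
        (a (seqIndex s) j * r / (2 * stageMesh a s : ℕ))| ↔ StageBad a s r := by
  have hM : 0 < arcDen s := (Nat.zero_le _).trans_lt (arcNum_lt_arcDen s)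
  have hM' : (0 : ℝ) < arcDen s := by exact_mod_cast hM
  have hL' : (0 : ℝ) < stageLevel s := by exact_mod_cast stageLevel_pos s
  have hR : 0 < 2 * stageMesh a s := by have := stageMesh_pos a s; omega
  have hhits : (((Finset.range (stageLength s)).filter fun j =>
      Int.fract ((a (seqIndex s) j : ℝ) * r / (2 * stageMesh a s : ℕ)) <
        (arcNum s : ℝ) / arcDen s).card : ℝ) = stageHits a s r := by
    rw [stageHits, Finset.card_filter]
    congr 1
    exact Finset.sum_congr rfl fun j _ => if_congr (fract_int_mul_div_lt_iff hR hM _ _) rfl rfl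
  rw [sum_arcDeviation_eq (by positivity)
    ((div_lt_one hM').2 (by exact_mod_cast arcNum_lt_arcDen s)), hhits, le_abs', StageBad]
  refine or_congr ?_ ?_
  · have e : (stageHits a s r : ℝ) * arcDen s * stageLevel s + stageLength s * arcDen s ≤
        arcNum s * stageLength s * stageLevel s ↔
        stageHits a s r * arcDen s * stageLevel s + stageLength s * arcDen s ≤
          arcNum s * stageLength s * stageLevel s := by exact_mod_cast Iff.rfl
    rw [← e, ← sub_nonneg, ← sub_nonneg (b := (_ + _ : ℝ)),
      ← mul_nonneg_iff_of_pos_left (mul_pos hM' hL')]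
    refine iff_of_eq (congrArg _ ?_)
    field_simp
    ring
  · have e : (arcNum s : ℝ) * stageLength s * stageLevel s + stageLength s * arcDen s ≤
        stageHits a s r * arcDen s * stageLevel s ↔
        arcNum s * stageLength s * stageLevel s + stageLength s * arcDen s ≤
          stageHits a s r * arcDen s * stageLevel s := by exact_mod_cast Iff.rfl
    rw [← e, ← sub_nonneg, ← sub_nonneg (b := (_ + _ : ℝ)),
      ← mul_nonneg_iff_of_pos_left (mul_pos hM' hL')]
    refine iff_of_eq (congrArg _ ?_)
    field_simp
    ring

/-! ### The Schnorr test and uniform distribution of the points passing it -/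

/-- The set of points contributed by stage `s`. -/
def stageSet (a : ℕ → ℕ → ℤ) (s : ℕ) : Set ℝ :=
  intervalUnion (fun s => 2 * stageMesh a s + 1)
    (fun s => 2 * stageMesh a s * (12 * stageLevel s ^ 4))
    (fun s r => r * (12 * stageLevel s ^ 4)) (stageRadius a) s

theorem isSchnorrTest_stageSet {a : ℕ → ℕ → ℤ} (ha : Computable₂ a)
    (hinj : ∀ i, Function.Injective (a i)) :
    IsSchnorrTest fun m => (⋃ s, stageSet a (2 ^ m + s)) ∩ Icc 0 1 := by
  have hR : Computable fun s => 2 * stageMesh a s :=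
    .natMul (.const 2) (computable_stageMesh ha)
  have hW : Computable fun s => 12 * stageLevel s ^ 4 :=
    .natMul (.const 12) (.natPow computable_stageLevel (.const 4))
  refine isSchnorrTest_of_stages (.natAdd hR (.const 1)) (.natMul hR hW)
    (.mk (.natMul .snd (hW.comp .fst))) (computable_stageRadius ha) (fun s => Nat.succ_pos _)
    (fun s => ?_) fun s hs => ?_
  · have := stageMesh_pos a s
    have := stageLevel_pos s
    positivity
  · have h1 := sum_two_mul_radius_le ((arcNum s : ℝ) / arcDen s) (stageLevel_pos s)
      (twelve_mul_le_two_mul_stageMesh a s) (hinj (seqIndex s))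
      (by rw [← stageLength]; exact dvd_two_mul_stageMesh a s)
      (StageBad a s) fun r _ hr => by
        have := (le_abs_sum_arcDeviation_iff_stageBad a s r).2 hr
        rwa [stageLength, Nat.cast_pow] at this
    refine h1.trans ?_
    have hs' : (0 : ℝ) < s := by exact_mod_cast hs
    -- The pairing function satisfies `pair t k < (max t k + 1) ^ 2`, so the bound `1 / L ^ 4` for
    -- stage `s` is at most `1 / (s * (s + 1))`.
    have h2 : s + 1 ≤ stageLevel s ^ 2 := by
      have h3 := Nat.pair_lt_max_add_one_sq s.unpair.1 s.unpair.2
      rw [Nat.pair_unpair] at h3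
      refine h3.trans_le (Nat.pow_le_pow_left ?_ 2)
      rw [stageLevel]
      omega
    have h2' : (s : ℝ) + 1 ≤ (stageLevel s : ℝ) ^ 2 := by exact_mod_cast h2
    refine one_div_le_one_div_of_le (by positivity) ?_
    calc (s : ℝ) * (s + 1) ≤ (stageLevel s : ℝ) ^ 2 * (stageLevel s : ℝ) ^ 2 := by
          gcongr; linarith
      _ = (stageLevel s : ℝ) ^ 4 := by ring

theorem abs_sum_arcDeviation_lt_of_notMem_stageSet {a : ℕ → ℕ → ℤ} {s : ℕ} {x : ℝ}
    (hx : x ∈ Icc (0 : ℝ) 1) (hxs : x ∉ stageSet a s) :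
    |∑ j ∈ Finset.range (stageLength s),
      arcDeviation ((arcNum s : ℝ) / arcDen s) (a (seqIndex s) j * x)| <
        (stageLength s : ℝ) / stageLevel s := by
  have hR : (0 : ℝ) < (2 * stageMesh a s : ℕ) := by
    have := stageMesh_pos a s
    positivity
  have hW : (0 : ℝ) < (12 * stageLevel s ^ 4 : ℕ) := by
    have := stageLevel_pos s
    positivity
  have hout : ∀ r ≤ 2 * stageMesh a s,
      (stageRadius a s r : ℝ) / ((2 * stageMesh a s : ℕ) * (12 * stageLevel s ^ 4 : ℕ)) ≤
        |x - r / (2 * stageMesh a s : ℕ)| := by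
    intro r hr
    by_contra! h
    refine hxs (mem_intervalUnion.2 ⟨r, Nat.lt_succ_of_le hr, ?_⟩)
    rw [abs_lt] at h
    rw [Nat.cast_mul, Nat.cast_mul (2 * stageMesh a s), sub_div, add_div,
      mul_div_mul_right _ _ hW.ne']
    constructor <;> linarith
  obtain ⟨r, hr, hdist, hsum⟩ := exists_grid_point_sum_arcDeviation_eq hx (arcNum_lt_arcDen s)
    (stageMesh_pos a s) (fun r hr h => by
      have h1 := hout r hr
      rw [sub_eq_zero.2 h, abs_zero] at h1
      have h2 : (0 : ℝ) < stageRadius a s r := by exact_mod_cast Nat.succ_pos _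
      have : 0 < (stageRadius a s r : ℝ) /
        ((2 * stageMesh a s : ℕ) * (12 * stageLevel s ^ 4 : ℕ)) := by positivity
      linarith) (arcDen_mul_dvd_stageMesh a s)
  rw [hsum, ← not_le, le_abs_sum_arcDeviation_iff_stageBad]
  intro hbad
  -- A bad grid point carries an interval of radius slightly larger than `1 / R`, which reaches
  -- every point of the adjacent cells of the refined grid.
  refine absurd (hout r hr) (not_le.2 (hdist.trans ?_))
  rw [stageRadius, if_pos hbad, div_lt_div_iff₀ hR (mul_pos hR hW), one_mul, mul_one, mul_comm]
  gcongr
  linarith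

theorem tendsto_add_natCast_succ_div (t : ℕ) :
    Tendsto (fun k : ℕ => ((t + (k + 1) + 1 : ℕ) : ℝ) / (t + k + 1 : ℕ)) atTop (𝓝 1) := by
  have h : ∀ k : ℕ, ((t + (k + 1) + 1 : ℕ) : ℝ) / (t + k + 1 : ℕ) =
      1 + 1 / (t + k + 1 : ℕ) := fun k => by
    push_cast
    field_simp
    ring
  simp only [h]
  have h2 : Tendsto (fun k : ℕ => t + k + 1) atTop atTop :=
    tendsto_atTop_mono (fun k => by simp only [id]; omega) tendsto_id
  simpa using (tendsto_one_div_atTop_nhds_zero_nat.comp h2).const_add (1 : ℝ)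

theorem uniformlyDistributedModOne_of_notMem_stageSet {a : ℕ → ℕ → ℤ} {x : ℝ}
    (hx : x ∈ Icc (0 : ℝ) 1) {S : ℕ} (hxs : ∀ s, S ≤ s → x ∉ stageSet a s) (i : ℕ) :
    UniformlyDistributedModOne fun j => (a i j : ℝ) * x := by
  refine uniformlyDistributedModOne_of_freqBelow fun e f => ?_
  -- The stages `Nat.pair t k`, for `k` varying, all test this sequence and this arc, with tolerance
  -- `1 / (t + k + 1)`.
  set t := Nat.pair i (Nat.pair e f) with ht
  set c : ℝ := (e : ℝ) / (e + f + 1) with hc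
  have hc0 : 0 ≤ c := by positivity
  have hc1 : c < 1 := (div_lt_one (by positivity)).2 (by linarith [(Nat.cast_nonneg f : (0 : ℝ) ≤ f)])
  set N : ℕ → ℕ := fun k => (32 * (t + k + 1) ^ 6) ^ 3 with hN
  have hNreal : ∀ k, (N k : ℝ) = 32 ^ 3 * ((t + k + 1 : ℕ) : ℝ) ^ 18 := fun k => by
    simp only [hN]; push_cast; ring
  have hNpos : ∀ k, (0 : ℝ) < N k := fun k => by rw [hNreal]; positivity
  have hlevel : Tendsto (fun k : ℕ => t + k + 1) atTop atTop :=
    tendsto_atTop_mono (fun k => by simp only [id]; omega) tendsto_id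
  have hNtop : Tendsto N atTop atTop := by
    refine tendsto_atTop_mono (fun k => ?_) hlevel
    have h1 : t + k + 1 ≤ (t + k + 1) ^ 6 := Nat.le_self_pow (by norm_num) _
    have h2 : 32 * (t + k + 1) ^ 6 ≤ N k := Nat.le_self_pow (by norm_num) _
    omega
  have hfreq : ∀ k, S ≤ k →
      |freqBelow (fun j => (a i j : ℝ) * x) c (N k) - c| ≤ 1 / ((t + k + 1 : ℕ) : ℝ) := by
    intro k hk
    have h := abs_sum_arcDeviation_lt_of_notMem_stageSet hx
      (hxs (Nat.pair t k) (hk.trans (Nat.right_le_pair t k)))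
    have e1 : seqIndex (Nat.pair t k) = i := by simp [seqIndex, ht]
    have e2 : arcNum (Nat.pair t k) = e := by simp [arcNum, ht]
    have e3 : arcDen (Nat.pair t k) = e + f + 1 := by rw [arcDen, e2]; simp [ht]
    have e4 : stageLevel (Nat.pair t k) = t + k + 1 := by simp [stageLevel]
    have e5 : stageLength (Nat.pair t k) = N k := by rw [stageLength, e4]
    rw [e1, e2, e3, e5, e4, show (e : ℝ) / (e + f + 1 : ℕ) = c by rw [hc]; push_cast; rfl,
      sum_arcDeviation_eq hc0 hc1 fun j => (a i j : ℝ) * x] at h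
    rw [freqBelow, div_sub' (hNpos k).ne', abs_div, abs_of_pos (hNpos k), div_le_iff₀ (hNpos k),
      one_div_mul_eq_div]
    exact h.le
  -- The count of hits is monotone and `N (k + 1) / N k → 1`, so the limit along `N` gives the limit
  -- along all lengths.
  refine tendsto_div_of_monotone_of_exists_subseq_tendsto_div
    (fun n => (((Finset.range n).filter fun j => Int.fract ((a i j : ℝ) * x) < c).card : ℝ)) c
    (fun n n' h => ?_) fun α hα => ⟨N, ?_, hNtop, ?_⟩
  · simp only
    gcongr
  · have h := (tendsto_add_natCast_succ_div t).pow 18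
    rw [one_pow] at h
    filter_upwards [h.eventually_le_const hα] with k hk
    rw [hNreal, hNreal]
    rw [div_pow, div_le_iff₀ (by positivity)] at hk
    linarith
  · rw [tendsto_iff_norm_sub_tendsto_zero]
    refine squeeze_zero' (Eventually.of_forall fun _ => norm_nonneg _) ?_
      (tendsto_one_div_atTop_nhds_zero_nat.comp hlevel)
    filter_upwards [eventually_ge_atTop S] with k hk
    exact hfreq k hk

theorem exists_isSchnorrTest_forall_uniformlyDistributedModOne {a : ℕ → ℕ → ℤ}
    (ha : Computable₂ a) (hinj : ∀ i, Function.Injective (a i)) :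
    ∃ G : ℕ → Set ℝ, IsSchnorrTest G ∧ ∀ x ∈ Icc (0 : ℝ) 1, PassesTest x G →
      ∀ i, UniformlyDistributedModOne fun j => (a i j : ℝ) * x := by
  refine ⟨_, isSchnorrTest_stageSet ha hinj, fun x hx hpass => ?_⟩
  rw [PassesTest, mem_iInter, not_forall] at hpass
  obtain ⟨m, hm⟩ := hpass
  refine uniformlyDistributedModOne_of_notMem_stageSet hx (S := 2 ^ m) fun s hs hxs => hm ⟨?_, hx⟩
  exact mem_iUnion.2 ⟨s - 2 ^ m, by rwa [Nat.add_sub_cancel' hs]⟩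

theorem mainTheorem1 :
    (∀ x : ℝ, IsSchnorrRandom x → IsUDRandom x) ∧
    (∀ a : ℕ → ℕ → ℤ, Computable₂ a → (∀ i, Function.Injective (a i)) →
      ∃ G : ℕ → Set ℝ, IsSchnorrTest G ∧
        ∀ x ∈ Set.Icc (0 : ℝ) 1, PassesTest x G →
          ∀ i, UniformlyDistributedModOne fun j => (a i j : ℝ) * x) := by
  refine ⟨fun x hx => ⟨hx.1, fun a ha hinj => ?_⟩, fun a ha hinj =>
    exists_isSchnorrTest_forall_uniformlyDistributedModOne ha hinj⟩
  obtain ⟨G, hG, hGx⟩ := exists_isSchnorrTest_forall_uniformlyDistributedModOne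
    (a := fun _ => a) (.mk (ha.comp .snd)) fun _ => hinj
  exact hGx x hx.1 (hx.2 G hG) 0
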